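/- For a real number $\alpha$ put $f_\alpha(t):=t^{1+i\alpha}$ for $t\ge 0$ and, for $x=(\xi_k)\in\ell_2$ (complex sequences), $$(\Omega_\alpha(x))_k:=\begin{cases}\xi_k\, f_\alpha\!\left(\log\frac{\|x\|_2}{|\xi_k|}\right)&\text{if }\xi_k\ne 0,\\ 0&\text{otherwise.}\end{cases}$$ Let Kalton's space $Z_\alpha$ be the complex linear space of all pairs $(x,y)$ of complex sequences with $x\in\ell_2$ and $y-\Omega_\alpha(x)\in\ell_2$, with the quasi-norm $\|(x,y)\|_\alpha:=\|x\|_2+\|y-\Omega_\alpha(x)\|_2$. Let $\mathfrak C_\alpha$ be the class of all bounded linear operators $T:X\to Y$ between complex Banach spaces that admit a factorization $T=BA$ over $Z_\alpha$, where $A:X\to Z_\alpha$ and $B:Z_\alpha\to Y$ are linear and bounded with respect to $\|\cdot\|_\alpha$. For a complex Banach space $X$ let $\overline X$ be its complex conjugate, i.e. $X$ with the scalar multiplication $a\odot x:=\overline a\,x$, and for $T:X\to Y$ let $\overline T:\overline X\to\overline Y$ be the same map. A complex operator ideal $\mathfrak C$ is self-conjugate if $\mathfrak C=\overline{\mathfrak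 C}$, where $\overline{\mathfrak C}$ consists of all $T:X\to Y$ such that $\overline T\in\mathfrak C(\overline X,\overline Y)$. Theorem. Let $\alpha\ne 0$ be real. Then $\mathfrak C_\alpha$ is a complex operator ideal (it contains all operators $x\mapsto\varphi(x)y$ of rank at most one, is closed under sums, and is stable under composition with bounded operators on either side), and $\mathfrak C_\alpha$ is not self-conjugate. Moreover $\mathfrak C_\alpha$ has no real analogue: there is no real operator ideal $\mathfrak A$ such that a bounded operator $T$ between complex Banach spaces belongs to $\mathfrak C_\alpha$ if and only if $T$, regarded as an operator between the underlying real Banach spaces, belongs to $\mathfrak A$. -/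

import Mathlib

open Complex

universe u

/-! ### Classes of operators between Banach spaces and operator ideals -/

/-- A class of bounded linear operators between Banach spaces over `𝕜`: for any two Banach spaces
`X`, `Y` a set of bounded linear operators from `X` to `Y`. -/
abbrev OperatorClass (𝕜 : Type) [RCLike 𝕜] : Type (u + 1) :=
  ∀ (X Y : Type u) [NormedAddCommGroup X] [NormedSpace 𝕜 X] [CompleteSpace X]
    [NormedAddCommGroup Y] [NormedSpace 𝕜 Y] [CompleteSpace Y], Set (X →L[𝕜] Y)

/-- Operator ideals over `𝕜`: the class contains the operators `x ↦ φ x • y`, is closed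
under sums, and is stable under composition with arbitrary bounded operators on both sides. -/
structure IsOperatorIdeal {𝕜 : Type} [RCLike 𝕜] (A : OperatorClass.{u} 𝕜) : Prop where
  rankOne_mem : ∀ (X Y : Type u) [NormedAddCommGroup X] [NormedSpace 𝕜 X] [CompleteSpace X]
    [NormedAddCommGroup Y] [NormedSpace 𝕜 Y] [CompleteSpace Y] (φ : X →L[𝕜] 𝕜) (y : Y),
    φ.smulRight y ∈ A X Y
  add_mem : ∀ (X Y : Type u) [NormedAddCommGroup X] [NormedSpace 𝕜 X] [CompleteSpace X]
    [NormedAddCommGroup Y] [NormedSpace 𝕜 Y] [CompleteSpace Y] (S T : X →L[𝕜] Y),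
    S ∈ A X Y → T ∈ A X Y → S + T ∈ A X Y
  comp_mem : ∀ (W X Y Z : Type u) [NormedAddCommGroup W] [NormedSpace 𝕜 W] [CompleteSpace W]
    [NormedAddCommGroup X] [NormedSpace 𝕜 X] [CompleteSpace X]
    [NormedAddCommGroup Y] [NormedSpace 𝕜 Y] [CompleteSpace Y]
    [NormedAddCommGroup Z] [NormedSpace 𝕜 Z] [CompleteSpace Z]
    (R : W →L[𝕜] X) (S : X →L[𝕜] Y) (T : Y →L[𝕜] Z),
    S ∈ A X Y → (T.comp S).comp R ∈ A W Z

/-! ### Complex conjugation -/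

/-- The complex conjugate of a complex Banach space `X`: the same additive group with the same
norm, and with the scalar multiplication `a ⊙ x = conj a • x`. -/
def ConjSpace (X : Type u) : Type u := X

namespace ConjSpace

variable {X Y : Type u}

instance [h : NormedAddCommGroup X] : NormedAddCommGroup (ConjSpace X) := h

instance [NormedAddCommGroup X] [h : CompleteSpace X] : CompleteSpace (ConjSpace X) := h

/-- The identity map from `X` to its conjugate, an isometry of additive groups. -/
def mk [NormedAddCommGroup X] : X ≃+ ConjSpace X := AddEquiv.refl X

noncomputable instance [NormedAddCommGroup X] [NormedSpace ℂ X] :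
    NormedSpace ℂ (ConjSpace X) where
  smul a x := mk ((starRingEnd ℂ) a • mk.symm x)
  one_smul x := by
    change mk ((starRingEnd ℂ) 1 • mk.symm x) = x
    simp
  mul_smul a b x := by
    change mk ((starRingEnd ℂ) (a * b) • mk.symm x)
      = mk ((starRingEnd ℂ) a • mk.symm (mk ((starRingEnd ℂ) b • mk.symm x)))
    simp [mul_smul]
  smul_zero a := by
    change mk ((starRingEnd ℂ) a • mk.symm (0 : ConjSpace X)) = 0
    simp
  smul_add a x y := by
    change mk ((starRingEnd ℂ) a • mk.symm (x + y))
      = mk ((starRingEnd ℂ) a • mk.symm x) + mk ((starRingEnd ℂ) a • mk.symm y)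
    simp
  add_smul a b x := by
    change mk ((starRingEnd ℂ) (a + b) • mk.symm x)
      = mk ((starRingEnd ℂ) a • mk.symm x) + mk ((starRingEnd ℂ) b • mk.symm x)
    simp [add_smul]
  zero_smul x := by
    change mk ((starRingEnd ℂ) 0 • mk.symm x) = 0
    simp
  norm_smul_le a x := by
    change ‖(starRingEnd ℂ) a • (mk.symm x : X)‖ ≤ ‖a‖ * ‖(mk.symm x : X)‖
    rw [norm_smul, RCLike.norm_conj]

theorem smul_def [NormedAddCommGroup X] [NormedSpace ℂ X] (a : ℂ) (x : ConjSpace X) :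
    a • x = mk ((starRingEnd ℂ) a • mk.symm x) := rfl

end ConjSpace

/-- The complex conjugate of `T : X → Y`: the same map, acting between the conjugate spaces. -/
noncomputable def conjOperator {X Y : Type u} [NormedAddCommGroup X] [NormedSpace ℂ X]
    [NormedAddCommGroup Y] [NormedSpace ℂ Y] (T : X →L[ℂ] Y) :
    ConjSpace X →L[ℂ] ConjSpace Y where
  toFun x := ConjSpace.mk (T (ConjSpace.mk.symm x))
  map_add' x y := by simp
  map_smul' a x := by simp [ConjSpace.smul_def]
  cont := T.continuous

/-- The conjugate class: all `T` whose conjugate belongs to the given class. -/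
def OperatorClass.conj (C : OperatorClass.{u} ℂ) : OperatorClass.{u} ℂ :=
  fun X Y _ _ _ _ _ _ => {T | conjOperator T ∈ C (ConjSpace X) (ConjSpace Y)}

/-- A class of complex operators is self-conjugate if it equals its conjugate class. -/
def OperatorClass.IsSelfConjugate (C : OperatorClass.{u} ℂ) : Prop := C = C.conj

/-- The complex class corresponding to a class of real operators: all complex operators that
belong to the real class when regarded as operators between the underlying real spaces. -/
def OperatorClass.toComplex (A : OperatorClass.{u} ℝ) : OperatorClass.{u} ℂ :=
  fun X Y _ _ _ _ _ _ => {T | T.restrictScalars ℝ ∈ A X Y}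

/-! ### Kalton's space -/

/-- The norm of `ℓ₂` (used only for square-summable sequences). -/
noncomputable def l2Norm (x : ℕ → ℂ) : ℝ := √(∑' k, ‖x k‖ ^ 2)

/-- The function `f_α(t) = t ^ (1 + iα)`, used for `t ≥ 0`. -/
noncomputable def kaltonFun (α t : ℝ) : ℂ := (t : ℂ) ^ (1 + α * I)

/-- Kalton's map `Ω_α`. -/
noncomputable def kaltonMap (α : ℝ) (x : ℕ → ℂ) : ℕ → ℂ :=
  fun k => if x k ≠ 0 then x k * kaltonFun α (Real.log (l2Norm x / ‖x k‖)) else 0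

theorem memLp_two_iff (x : ℕ → ℂ) : Memℓp x 2 ↔ Summable fun k => ‖x k‖ ^ 2 := by
  rw [memℓp_gen_iff (by norm_num)]
  simp

theorem norm_le_l2Norm {x : ℕ → ℂ} (hx : Memℓp x 2) (k : ℕ) : ‖x k‖ ≤ l2Norm x := by
  rw [memLp_two_iff] at hx
  exact Real.le_sqrt_of_sq_le (hx.le_tsum k fun _ _ => by positivity)

theorem l2Norm_smul (c : ℂ) (x : ℕ → ℂ) : l2Norm (c • x) = ‖c‖ * l2Norm x := by
  simp only [l2Norm, Pi.smul_apply, smul_eq_mul, norm_mul, mul_pow, tsum_mul_left]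
  rw [Real.sqrt_mul (by positivity), Real.sqrt_sq (norm_nonneg c)]

theorem memLp_two_of_norm_le {x y : ℕ → ℂ} (hy : Memℓp y 2) (C : ℝ)
    (h : ∀ k, ‖x k‖ ≤ C * ‖y k‖) : Memℓp x 2 := by
  rw [memLp_two_iff] at hy ⊢
  refine Summable.of_nonneg_of_le (fun _ => by positivity) (fun k => ?_) (hy.mul_left (C ^ 2))
  rw [← mul_pow]
  exact pow_le_pow_left₀ (norm_nonneg _) (h k) 2

theorem kaltonFun_lipschitz (α : ℝ) {s t : ℝ} (hs : 0 ≤ s) (ht : 0 ≤ t) :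
    ‖kaltonFun α s - kaltonFun α t‖ ≤ ‖(1 + α * I : ℂ)‖ * |s - t| := by
  have hr : (1 + α * I : ℂ) ≠ 0 := fun h => by simpa using congrArg Complex.re h
  have h1 : 1 ≤ ‖(1 + α * I : ℂ)‖ := by simpa using Complex.re_le_norm (1 + α * I : ℂ)
  have hz : kaltonFun α 0 = 0 := by simp [kaltonFun, Complex.zero_cpow hr]
  have hn : ∀ r : ℝ, 0 < r → ‖kaltonFun α r‖ ≤ ‖(1 + α * I : ℂ)‖ * r := fun r h => by
    rw [kaltonFun, Complex.norm_cpow_eq_rpow_re_of_pos h]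
    simpa using le_mul_of_one_le_left h.le h1
  rcases hs.eq_or_lt with rfl | hs
  · rcases ht.eq_or_lt with rfl | ht
    · simp
    · rw [hz, zero_sub, zero_sub, norm_neg, abs_neg, abs_of_pos ht]
      exact hn t ht
  · rcases ht.eq_or_lt with rfl | ht
    · rw [hz, sub_zero, sub_zero, abs_of_pos hs]
      exact hn s hs
    · refine (convex_Ioi (0 : ℝ)).norm_image_sub_le_of_norm_hasDerivWithin_le
        (fun x hx => (hasDerivAt_ofReal_cpow_const (ne_of_gt hx) hr).hasDerivWithinAt)
        (fun x hx => ?_) ht hs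
      rw [norm_mul, Complex.norm_cpow_eq_rpow_re_of_pos hx]
      simp

/-- Comparison of `Ω_α x` with a diagonal multiple of `x`. -/
theorem kaltonMap_sub_mem (α S : ℝ) {x w : ℕ → ℂ} (hx : Memℓp x 2) (hw : Memℓp w 2)
    (hxw : ∀ k, ‖x k‖ ≤ ‖w k‖) (hwS : ∀ k, ‖w k‖ ≤ S) :
    Memℓp (kaltonMap α x - fun k => x k * kaltonFun α (Real.log (S / ‖w k‖))) 2 := by
  refine memLp_two_of_norm_le hw
    (‖(1 + α * I : ℂ)‖ * (|Real.log (l2Norm x) - Real.log S| + 1)) fun k => ?_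
  by_cases hk : x k = 0
  · simp only [Pi.sub_apply, kaltonMap, hk]
    simp
    positivity
  have hxk : 0 < ‖x k‖ := norm_pos_iff.2 hk
  have hwk : 0 < ‖w k‖ := hxk.trans_le (hxw k)
  have hS : 0 < S := hwk.trans_le (hwS k)
  have hM := norm_le_l2Norm hx k
  have hM0 : 0 < l2Norm x := hxk.trans_le hM
  simp only [Pi.sub_apply, kaltonMap, ne_eq, hk, not_false_eq_true, if_true]
  rw [← mul_sub, norm_mul]
  have h1 := kaltonFun_lipschitz α (Real.log_nonneg ((one_le_div hxk).2 hM))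
    (Real.log_nonneg ((one_le_div hwk).2 (hwS k)))
  have h2 : ‖x k‖ * |Real.log (l2Norm x / ‖x k‖) - Real.log (S / ‖w k‖)|
      ≤ (|Real.log (l2Norm x) - Real.log S| + 1) * ‖w k‖ := by
    have e : Real.log (l2Norm x / ‖x k‖) - Real.log (S / ‖w k‖)
        = (Real.log (l2Norm x) - Real.log S) + Real.log (‖w k‖ / ‖x k‖) := by
      rw [Real.log_div hM0.ne' hxk.ne', Real.log_div hS.ne' hwk.ne',
        Real.log_div hwk.ne' hxk.ne']
      ring
    have h3 : 0 ≤ Real.log (‖w k‖ / ‖x k‖) := Real.log_nonneg ((one_le_div hxk).2 (hxw k))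
    have h4 : ‖x k‖ * Real.log (‖w k‖ / ‖x k‖) ≤ ‖w k‖ := by
      have := Real.log_le_self (div_pos hwk hxk).le
      calc _ ≤ ‖x k‖ * (‖w k‖ / ‖x k‖) := by gcongr
        _ = ‖w k‖ := by field_simp
    rw [e]
    calc _ ≤ ‖x k‖ * (|Real.log (l2Norm x) - Real.log S| + Real.log (‖w k‖ / ‖x k‖)) := by
          gcongr
          exact (abs_add_le _ _).trans_eq (by rw [abs_of_nonneg h3])
      _ ≤ _ := by
          have := mul_le_mul_of_nonneg_right (hxw k)
            (abs_nonneg (Real.log (l2Norm x) - Real.log S))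
          linarith
  calc _ ≤ ‖x k‖ * (‖(1 + α * I : ℂ)‖
        * |Real.log (l2Norm x / ‖x k‖) - Real.log (S / ‖w k‖)|) := by gcongr
    _ = ‖(1 + α * I : ℂ)‖
        * (‖x k‖ * |Real.log (l2Norm x / ‖x k‖) - Real.log (S / ‖w k‖)|) := by ring
    _ ≤ ‖(1 + α * I : ℂ)‖ * ((|Real.log (l2Norm x) - Real.log S| + 1) * ‖w k‖) := by gcongr
    _ = _ := by ring

theorem kaltonMap_add_sub_mem (α : ℝ) {x y : ℕ → ℂ} (hx : Memℓp x 2) (hy : Memℓp y 2) :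
    Memℓp (kaltonMap α (x + y) - kaltonMap α x - kaltonMap α y) 2 := by
  let w : ℕ → ℂ := fun k => ((‖x k‖ + ‖y k‖ : ℝ) : ℂ)
  have hwn : ∀ k, ‖w k‖ = ‖x k‖ + ‖y k‖ := fun k => by
    simp only [w, Complex.norm_real, Real.norm_eq_abs]
    exact abs_of_nonneg (by positivity)
  have hx' : Memℓp (fun k => ((‖x k‖ : ℝ) : ℂ)) 2 :=
    memLp_two_of_norm_le hx 1 fun k => by simp
  have hy' : Memℓp (fun k => ((‖y k‖ : ℝ) : ℂ)) 2 :=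
    memLp_two_of_norm_le hy 1 fun k => by simp
  have hw : Memℓp w 2 := by
    convert hx'.add hy' using 1
    funext k
    simp [w]
  have hS : ∀ k, ‖w k‖ ≤ l2Norm x + l2Norm y := fun k => by
    rw [hwn]
    exact add_le_add (norm_le_l2Norm hx k) (norm_le_l2Norm hy k)
  have e1 := kaltonMap_sub_mem α _ hx hw (fun k => by rw [hwn]; simp) hS
  have e2 := kaltonMap_sub_mem α _ hy hw (fun k => by rw [hwn]; simp) hS
  have e3 := kaltonMap_sub_mem α _ (hx.add hy) hw
    (fun k => by rw [hwn]; exact norm_add_le _ _) hS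
  convert (e3.sub e1).sub e2 using 1
  funext k
  simp only [Pi.sub_apply, Pi.add_apply]
  ring

theorem kaltonMap_smul (α : ℝ) (c : ℂ) (x : ℕ → ℂ) :
    kaltonMap α (c • x) = c • kaltonMap α x := by
  funext k
  by_cases hc : c = 0
  · simp [hc, kaltonMap]
  by_cases hk : x k = 0
  · simp [kaltonMap, hk]
  have : ‖c‖ * l2Norm x / (‖c‖ * ‖x k‖) = l2Norm x / ‖x k‖ :=
    mul_div_mul_left _ _ (norm_ne_zero_iff.2 hc)
  simp [kaltonMap, hc, hk, l2Norm_smul, this, mul_assoc]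

/-- Kalton's space `Z_α`: all pairs `(x, y)` of complex sequences such that both `x` and
`y - Ω_α x` belong to `ℓ₂`. -/
noncomputable def kaltonSpace (α : ℝ) : Submodule ℂ ((ℕ → ℂ) × (ℕ → ℂ)) where
  carrier := {z | Memℓp z.1 2 ∧ Memℓp (z.2 - kaltonMap α z.1) 2}
  zero_mem' := by
    refine ⟨zero_memℓp, ?_⟩
    convert zero_memℓp (E := fun _ : ℕ => ℂ) (p := 2) using 1
    funext k
    simp [kaltonMap]
  add_mem' := by
    rintro z z' ⟨h1, h2⟩ ⟨h1', h2'⟩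
    refine ⟨h1.add h1', ?_⟩
    convert (h2.add h2').sub (kaltonMap_add_sub_mem α h1 h1') using 1
    funext k
    simp only [Prod.fst_add, Prod.snd_add, Pi.sub_apply, Pi.add_apply]
    ring
  smul_mem' := by
    rintro c z ⟨h1, h2⟩
    refine ⟨h1.const_smul c, ?_⟩
    convert h2.const_smul c using 1
    rw [Prod.smul_fst, Prod.smul_snd, kaltonMap_smul, smul_sub]

/-- The quasi-norm `‖(x, y)‖_α = ‖x‖₂ + ‖y - Ω_α x‖₂` of `Z_α`. -/
noncomputable def kaltonQuasiNorm (α : ℝ) (z : kaltonSpace α) : ℝ :=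
  l2Norm z.1.1 + l2Norm (z.1.2 - kaltonMap α z.1.1)

/-- The class of all operators `T` that factor over `Z_α`, that is `T = B ∘ A` with linear maps
`A : X → Z_α` and `B : Z_α → Y` that are bounded with respect to the quasi-norm of `Z_α`
(equivalently, with respect to any norm on `Z_α` equivalent to it). -/
def kaltonIdeal (α : ℝ) : OperatorClass.{u} ℂ :=
  fun X Y _ _ _ _ _ _ => {T | ∃ (A : X →ₗ[ℂ] kaltonSpace α) (B : kaltonSpace α →ₗ[ℂ] Y),
    (∃ C : ℝ, ∀ x, kaltonQuasiNorm α (A x) ≤ C * ‖x‖) ∧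
    (∃ C : ℝ, ∀ z, ‖B z‖ ≤ C * kaltonQuasiNorm α z) ∧
    ∀ x, T x = B (A x)}

/-!
The space `Z_α` is a twisted sum of two Hilbert spaces: the vectors `(0, y)` form a copy of `ℓ₂`,
and so does the quotient, which is given by `(x, y) ↦ x`. Two facts about Kalton's map are behind
everything else. First, `Ω_α` may be replaced, up to bounded errors, by a map
acting coordinatewise (`kaltonMap_sub_scaledMap`). Secondly, it is additive up to an error that is
bounded independently of the number of summands (`sum_kaltonMap_sub_kaltonMap_sum`); this is a
relative entropy estimate, and it makes the quasi-norm equivalent to a norm. As `Z_α` is complete,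
it is a Banach space `KaltonBanach α`. Being the direct sum of two copies of itself, `Z_α` gives
rise to an operator ideal.

The identity of `Z_α` belongs to this ideal. If its conjugate did so as well, there would be a
conjugate-linear operator `A` from `Z_α` into itself that is bounded from below. This is impossible
(`kaltonSpace.not_bounded_below`). Write `A (0, e_k) = (s_k, t_k)` and `A (e_k, 0) = (x_k, y_k)`.
By a gliding hump (`exists_blocks`) and by averaging over multiplications with unimodular sequences
(`kaltonSpace.quasiNorm_sum_blockProj_le`) these vectors may be restricted to disjoint blocks.
The sum of `n` vectors `(0, e_k)` has quasi-norm `√n`, whereas `n` disjoint vectors with first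
components of norm at least `δ` have a sum of quasi-norm at least of order `δ √n log n`. Hence
`s_k → 0`, and `(s_k, t_k)` is close to `(0, r_k)`, where `r_k = t_k - Ω_α s_k` stays away from zero.
Now `A` is applied to the sum of the vectors `(e_k, f_α(L) e_k)`, where `L = log √n`, which has
quasi-norm `√n`, too. By conjugate linearity the image is essentially a sum of blocks
`(x_k, y_k + conj f_α(L) r_k)`, and comparing normalizations
(`kaltonSpace.exists_block_hasL2Bound`) shows that, for all but fewer than `n` indices `k`,

  `conj f_α(L) r_k - x_k (f_α(m + L) - f_α(m))` with `m = log (C / |x_k|)`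

is bounded in `ℓ₂` by a constant that does not depend on `L`. So some `k` is good for several values
of `L` at once. But `conj f_α(L)` and the increments of `f_α` have phases that depend on `L` in
different ways when `α ≠ 0`, whatever `m` is (`exists_scales_mul_norm_le`), and therefore `r_k` has
to be small: a contradiction.

Finally, a complex space and its conjugate have the same underlying real space, so that every class
that comes from a real operator ideal is self-conjugate.
-/

/-! ### Square-summable sequences -/

/-- `x` is square-summable with `ℓ₂`-norm at most `C`. -/
structure HasL2Bound (x : ℕ → ℂ) (C : ℝ) : Prop where
  mem : Memℓp x 2
  le : l2Norm x ≤ C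

theorem l2Norm_nonneg (x : ℕ → ℂ) : 0 ≤ l2Norm x := Real.sqrt_nonneg _

theorem l2Norm_sq (x : ℕ → ℂ) : l2Norm x ^ 2 = ∑' k, ‖x k‖ ^ 2 :=
  Real.sq_sqrt (tsum_nonneg fun _ => by positivity)

theorem Memℓp.hasL2Bound {x : ℕ → ℂ} (hx : Memℓp x 2) : HasL2Bound x (l2Norm x) := ⟨hx, le_rfl⟩

theorem sum_norm_sq_le {x : ℕ → ℂ} (hx : Memℓp x 2) (s : Finset ℕ) :
    ∑ k ∈ s, ‖x k‖ ^ 2 ≤ l2Norm x ^ 2 := by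
  rw [l2Norm_sq]
  exact ((memLp_two_iff x).1 hx).sum_le_tsum s fun _ _ => by positivity

theorem l2Norm_eq_norm {x : ℕ → ℂ} (hx : Memℓp x 2) :
    l2Norm x = ‖(⟨x, hx⟩ : lp (fun _ : ℕ => ℂ) 2)‖ := by
  rw [lp.norm_eq_tsum_rpow (by norm_num), l2Norm, Real.sqrt_eq_rpow]
  simp

namespace HasL2Bound

variable {x y : ℕ → ℂ} {C D : ℝ}

theorem nonneg (h : HasL2Bound x C) : 0 ≤ C := (l2Norm_nonneg x).trans h.le

theorem mono (h : HasL2Bound x C) (hCD : C ≤ D) : HasL2Bound x D := ⟨h.mem, h.le.trans hCD⟩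

theorem sum_sq_le (h : HasL2Bound x C) (s : Finset ℕ) : ∑ k ∈ s, ‖x k‖ ^ 2 ≤ C ^ 2 :=
  (sum_norm_sq_le h.mem s).trans (pow_le_pow_left₀ (l2Norm_nonneg x) h.le 2)

theorem of_sum_sq_le (hC : 0 ≤ C) (h : ∀ s : Finset ℕ, ∑ k ∈ s, ‖x k‖ ^ 2 ≤ C ^ 2) :
    HasL2Bound x C := by
  have hs : Summable fun k => ‖x k‖ ^ 2 := summable_of_sum_le (fun _ => by positivity) h
  exact ⟨(memLp_two_iff x).2 hs, (Real.sqrt_le_sqrt (hs.tsum_le_of_sum_le h)).trans_eq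
    (Real.sqrt_sq hC)⟩

theorem norm_le (h : HasL2Bound x C) (k : ℕ) : ‖x k‖ ≤ C := (norm_le_l2Norm h.mem k).trans h.le

theorem zero : HasL2Bound 0 0 := of_sum_sq_le le_rfl fun s => by simp

theorem add (hx : HasL2Bound x C) (hy : HasL2Bound y D) : HasL2Bound (x + y) (C + D) := by
  refine ⟨hx.mem.add hy.mem, ?_⟩
  have hx' := hx.le
  have hy' := hy.le
  rw [l2Norm_eq_norm hx.mem] at hx'
  rw [l2Norm_eq_norm hy.mem] at hy'
  rw [l2Norm_eq_norm (hx.mem.add hy.mem)]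
  exact (norm_add_le (⟨x, hx.mem⟩ : lp (fun _ : ℕ => ℂ) 2) ⟨y, hy.mem⟩).trans (add_le_add hx' hy')

theorem smul (c : ℂ) (hx : HasL2Bound x C) : HasL2Bound (c • x) (‖c‖ * C) :=
  ⟨hx.mem.const_smul c, (l2Norm_smul c x).trans_le
    (mul_le_mul_of_nonneg_left hx.le (norm_nonneg c))⟩

theorem of_norm_le (hy : HasL2Bound y C) (h : ∀ k, ‖x k‖ ≤ ‖y k‖) : HasL2Bound x C :=
  of_sum_sq_le hy.nonneg fun s => (Finset.sum_le_sum fun k _ =>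
    pow_le_pow_left₀ (norm_nonneg _) (h k) 2).trans (hy.sum_sq_le s)

theorem of_norm_le_mul (hy : HasL2Bound y C) {c : ℝ} (hc : 0 ≤ c)
    (h : ∀ k, ‖x k‖ ≤ c * ‖y k‖) : HasL2Bound x (c * C) := by
  have := hy.smul (c : ℂ)
  rw [Complex.norm_real, Real.norm_of_nonneg hc] at this
  exact this.of_norm_le fun k => by simpa [abs_of_nonneg hc] using h k

theorem neg (hx : HasL2Bound x C) : HasL2Bound (-x) C := hx.of_norm_le fun k => by simp

theorem sub (hx : HasL2Bound x C) (hy : HasL2Bound y D) : HasL2Bound (x - y) (C + D) := by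
  rw [sub_eq_add_neg]
  exact hx.add hy.neg

theorem abs (hx : HasL2Bound x C) : HasL2Bound (fun k => ((‖x k‖ : ℝ) : ℂ)) C :=
  hx.of_norm_le fun k => by simp

theorem sum {ι : Type*} (s : Finset ι) {x : ι → ℕ → ℂ} {C : ι → ℝ}
    (h : ∀ i ∈ s, HasL2Bound (x i) (C i)) : HasL2Bound (∑ i ∈ s, x i) (∑ i ∈ s, C i) := by
  classical
  induction s using Finset.induction_on with
  | empty => simpa using zero
  | insert a s ha ih =>
    rw [Finset.sum_insert ha, Finset.sum_insert ha]
    exact (h a (Finset.mem_insert_self a s)).add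
      (ih fun i hi => h i (Finset.mem_insert_of_mem hi))

theorem comp (hx : HasL2Bound x C) {e : ℕ → ℕ} (he : Function.Injective e) :
    HasL2Bound (x ∘ e) C := by
  refine of_sum_sq_le hx.nonneg fun s => ?_
  have := hx.sum_sq_le (s.map ⟨e, he⟩)
  simpa using this

end HasL2Bound

theorem l2Norm_eq_zero {x : ℕ → ℂ} (hx : Memℓp x 2) (h : l2Norm x = 0) : x = 0 := by
  funext k
  have := norm_le_l2Norm hx k
  rw [h] at this
  simpa using this

@[simp] theorem l2Norm_zero : l2Norm 0 = 0 := by simp [l2Norm]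

/-! ### The function `t ^ (1 + iα)` -/

/-- The Lipschitz constant `|1 + iα|` of `f_α`. -/
noncomputable def kaltonLip (α : ℝ) : ℝ := ‖(1 + α * I : ℂ)‖

theorem one_le_kaltonLip (α : ℝ) : 1 ≤ kaltonLip α := by
  simpa [kaltonLip] using Complex.re_le_norm (1 + α * I : ℂ)

theorem kaltonLip_nonneg (α : ℝ) : 0 ≤ kaltonLip α := norm_nonneg _

theorem norm_kaltonFun (α : ℝ) {t : ℝ} (ht : 0 ≤ t) : ‖kaltonFun α t‖ = t := by
  rcases ht.eq_or_lt with rfl | ht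
  · have hr : (1 + α * I : ℂ) ≠ 0 := fun h => by simpa using congrArg Complex.re h
    simp [kaltonFun, Complex.zero_cpow hr]
  · rw [kaltonFun, Complex.norm_cpow_eq_rpow_re_of_pos ht]
    simp

theorem kaltonFun_zero (α : ℝ) : kaltonFun α 0 = 0 :=
  norm_eq_zero.1 (norm_kaltonFun α le_rfl)

theorem continuous_kaltonFun (α : ℝ) : Continuous (kaltonFun α) :=
  continuous_iff_continuousAt.2 fun t =>
    Complex.continuousAt_ofReal_cpow_const t (1 + α * I) (Or.inl (by simp))

theorem kaltonFun_mul (α : ℝ) {s t : ℝ} (hs : 0 ≤ s) (ht : 0 ≤ t) :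
    kaltonFun α (s * t) = kaltonFun α s * kaltonFun α t := by
  simp only [kaltonFun]
  push_cast
  exact Complex.mul_cpow_ofReal_nonneg hs ht _

/-! ### Kalton's map with a prescribed normalization -/

/-- The map `x ↦ x · f_α(log (S / |x|))`, in which the norm of `x` in the definition of `Ω_α x` is
replaced by a constant `S`. Unlike `Ω_α` it acts coordinatewise. -/
noncomputable def scaledMap (α S : ℝ) (x : ℕ → ℂ) : ℕ → ℂ :=
  fun k => x k * kaltonFun α (Real.log (S / ‖x k‖))

theorem kaltonMap_eq_scaledMap (α : ℝ) (x : ℕ → ℂ) :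
    kaltonMap α x = scaledMap α (l2Norm x) x := by
  funext k
  by_cases hk : x k = 0 <;> simp [kaltonMap, scaledMap, hk]

theorem log_div_norm_nonneg {a : ℂ} {S : ℝ} (h : ‖a‖ ≤ S) : 0 ≤ Real.log (S / ‖a‖) := by
  rcases eq_or_ne a 0 with rfl | ha
  · simp
  · exact Real.log_nonneg ((one_le_div (norm_pos_iff.2 ha)).2 h)

/-- Changing the normalization of Kalton's map costs an error bounded in `ℓ₂`. -/
theorem kaltonMap_sub_scaledMap (α : ℝ) {S : ℝ} {x : ℕ → ℂ} (hx : HasL2Bound x S) :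
    HasL2Bound (kaltonMap α x - scaledMap α S x) (kaltonLip α * S) := by
  rcases (l2Norm_nonneg x).eq_or_lt with h0 | h0
  · have : x = 0 := l2Norm_eq_zero hx.mem h0.symm
    subst this
    refine (HasL2Bound.zero.mono (mul_nonneg (kaltonLip_nonneg α) hx.nonneg)).of_norm_le
      fun k => ?_
    simp [kaltonMap, scaledMap]
  have hS : 0 < S := h0.trans_le hx.le
  have hl : 0 ≤ Real.log (S / l2Norm x) := Real.log_nonneg ((one_le_div h0).2 hx.le)
  refine (hx.mem.hasL2Bound.of_norm_le_mul
    (mul_nonneg (kaltonLip_nonneg α) hl) fun k => ?_).mono ?_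
  · rw [kaltonMap_eq_scaledMap]
    simp only [Pi.sub_apply, scaledMap, ← mul_sub, norm_mul]
    rcases eq_or_ne (x k) 0 with hk | hk
    · simp [hk]
    have hk' := norm_pos_iff.2 hk
    have := kaltonFun_lipschitz α (log_div_norm_nonneg (norm_le_l2Norm hx.mem k))
      (log_div_norm_nonneg (hx.norm_le k))
    have e : |Real.log (l2Norm x / ‖x k‖) - Real.log (S / ‖x k‖)| = Real.log (S / l2Norm x) := by
      rw [Real.log_div h0.ne' hk'.ne', Real.log_div hS.ne' hk'.ne', abs_sub_comm,
        ← abs_of_nonneg hl, Real.log_div hS.ne' h0.ne']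
      congr 1
      ring
    rw [e] at this
    rw [mul_comm]
    exact mul_le_mul_of_nonneg_right this (norm_nonneg _)
  · rw [mul_assoc]
    refine mul_le_mul_of_nonneg_left ?_ (kaltonLip_nonneg α)
    calc Real.log (S / l2Norm x) * l2Norm x ≤ S / l2Norm x * l2Norm x := by
          gcongr
          exact Real.log_le_self (by positivity)
      _ = S := by field_simp

theorem norm_scaledMap_le (α : ℝ) {S : ℝ} {x : ℕ → ℂ} {k : ℕ} (h : ‖x k‖ ≤ S) :
    ‖scaledMap α S x k‖ ≤ S := by
  rcases eq_or_ne (x k) 0 with hk | hk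
  · simpa [scaledMap, hk] using h
  have hk' := norm_pos_iff.2 hk
  rw [scaledMap, norm_mul, norm_kaltonFun α (log_div_norm_nonneg h)]
  calc ‖x k‖ * Real.log (S / ‖x k‖) ≤ ‖x k‖ * (S / ‖x k‖) := by
        gcongr
        exact Real.log_le_self (div_nonneg (hk'.le.trans h) hk'.le)
    _ = S := by field_simp

theorem norm_kaltonMap_le (α : ℝ) {x : ℕ → ℂ} (hx : Memℓp x 2) (k : ℕ) :
    ‖kaltonMap α x k‖ ≤ l2Norm x := by
  rw [kaltonMap_eq_scaledMap]
  exact norm_scaledMap_le α (norm_le_l2Norm hx k)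

/-! ### Kalton's map is additive up to a bounded error -/

theorem abs_log_le_add_sqrt {r : ℝ} (hr : 0 < r) : |Real.log r| ≤ r + 2 * √(1 / r) := by
  have h1 : 0 < √(1 / r) := Real.sqrt_pos.2 (by positivity)
  rw [abs_le]
  constructor
  · have h2 : Real.log (1 / r) = 2 * Real.log √(1 / r) := by
      rw [Real.log_sqrt (by positivity)]
      ring
    have h3 := Real.log_le_self h1.le
    rw [one_div, Real.log_inv] at h2
    rw [one_div] at h3 ⊢
    linarith
  · have := Real.log_le_self hr.le
    linarith

/-- A relative entropy estimate: with the probability vectors `μ i = a i / ∑ a` and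
`lam i = A i / ∑ A`, the left-hand side is `∑ a` times the mean of `|log (lam i / μ i)|`
with respect to `μ`. -/
theorem sum_mul_abs_log_sub_log_le {ι : Type*} (s : Finset ι) (a A : ι → ℝ)
    (ha : ∀ i ∈ s, 0 ≤ a i) (haA : ∀ i ∈ s, a i ≤ A i) :
    ∑ i ∈ s, a i * |Real.log (A i / a i) - Real.log ((∑ i ∈ s, A i) / ∑ i ∈ s, a i)|
      ≤ ∑ i ∈ s, a i + 2 * √((∑ i ∈ s, A i) * ∑ i ∈ s, a i ^ 2 / A i) := by
  set S := ∑ i ∈ s, A i with hSdef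
  set w := ∑ i ∈ s, a i with hwdef
  have hA : ∀ i ∈ s, 0 ≤ A i := fun i hi => (ha i hi).trans (haA i hi)
  rcases (Finset.sum_nonneg ha).eq_or_lt with h0 | hw
  · have hz := (Finset.sum_eq_zero_iff_of_nonneg ha).1 h0.symm
    rw [Finset.sum_eq_zero fun i hi => by rw [hz i hi, zero_mul], hwdef, ← h0]
    positivity
  have hS : 0 < S := hw.trans_le (Finset.sum_le_sum haA)
  rw [← hwdef] at hw
  have hterm : ∀ i ∈ s, a i * |Real.log (A i / a i) - Real.log (S / w)|
      ≤ A i * (w / S) + 2 * (√(a i) * √(S / w * (a i ^ 2 / A i))) := fun i hi => by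
    rcases (ha i hi).eq_or_lt with h0 | hai
    · rw [← h0]
      have := hA i hi
      simp only [zero_mul]
      positivity
    have hAi : 0 < A i := hai.trans_le (haA i hi)
    have e : Real.log (A i / a i) - Real.log (S / w) = Real.log (A i * w / (S * a i)) := by
      rw [← Real.log_div (by positivity) (by positivity)]
      congr 1
      field_simp
    rw [e]
    have h2 := abs_log_le_add_sqrt (show 0 < A i * w / (S * a i) by positivity)
    have h3 : a i * √(1 / (A i * w / (S * a i))) = √(a i) * √(S / w * (a i ^ 2 / A i)) := by
      rw [← Real.sqrt_mul hai.le]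
      conv_lhs => rw [← Real.sqrt_sq hai.le]
      rw [← Real.sqrt_mul (by positivity)]
      congr 1
      rw [Real.sqrt_sq hai.le]
      field_simp
    calc _ ≤ a i * (A i * w / (S * a i) + 2 * √(1 / (A i * w / (S * a i)))) := by gcongr
      _ = a i * (A i * w / (S * a i)) + 2 * (a i * √(1 / (A i * w / (S * a i)))) := by ring
      _ = _ := by
          rw [h3]
          congr 1
          field_simp
  refine (Finset.sum_le_sum hterm).trans ?_
  rw [Finset.sum_add_distrib, ← Finset.sum_mul, ← Finset.mul_sum, ← hSdef]
  have h1 : S * (w / S) = w := by field_simp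
  rw [h1]
  have hq : ∀ i ∈ s, 0 ≤ S / w * (a i ^ 2 / A i) := fun i hi => by
    have := hA i hi
    positivity
  have hcs := Real.sum_mul_le_sqrt_mul_sqrt s (fun i => √(a i))
    (fun i => √(S / w * (a i ^ 2 / A i)))
  rw [Finset.sum_congr rfl fun i hi => Real.sq_sqrt (ha i hi),
    Finset.sum_congr rfl fun i hi => Real.sq_sqrt (hq i hi), ← Finset.mul_sum, ← hwdef,
    ← Real.sqrt_mul hw.le, ← mul_assoc, mul_div_cancel₀ _ hw.ne'] at hcs
  linarith

/-- The quantitative form of the fact that `Z_α` is locally convex. -/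
theorem sum_kaltonMap_sub_kaltonMap_sum (α : ℝ) {ι : Type*} (s : Finset ι) {x : ι → ℕ → ℂ}
    (hx : ∀ i ∈ s, Memℓp (x i) 2) :
    HasL2Bound (∑ i ∈ s, kaltonMap α (x i) - kaltonMap α (∑ i ∈ s, x i))
      (5 * kaltonLip α * ∑ i ∈ s, l2Norm (x i)) := by
  set S := ∑ i ∈ s, l2Norm (x i) with hSdef
  set X := ∑ i ∈ s, x i with hXdef
  have hκ := kaltonLip_nonneg α
  have hX : HasL2Bound X S := HasL2Bound.sum s fun i hi => (hx i hi).hasL2Bound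
  -- The common reference: all terms are compared with multiplication by `f_α(log (S / w))`.
  let w : ℕ → ℝ := fun k => ∑ i ∈ s, ‖x i k‖
  have hw0 : ∀ k, 0 ≤ w k := fun k => Finset.sum_nonneg fun _ _ => norm_nonneg _
  have hw : HasL2Bound (fun k => (w k : ℂ)) S := by
    convert HasL2Bound.sum s fun i hi => (hx i hi).hasL2Bound.abs using 1
    funext k
    simp [w]
  have hwS : ∀ k, w k ≤ S := fun k => (Real.le_norm_self _).trans
    (by simpa using hw.norm_le k)
  have hwlog : ∀ k, 0 ≤ Real.log (S / w k) := fun k => by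
    rcases (hw0 k).eq_or_lt with h | h
    · simp [← h]
    · exact Real.log_nonneg ((one_le_div h).2 (hwS k))
  let g : ℕ → ℝ := fun k => √(S * ∑ i ∈ s, ‖x i k‖ ^ 2 / l2Norm (x i))
  have hg : HasL2Bound (fun k => (g k : ℂ)) S := by
    refine HasL2Bound.of_sum_sq_le hX.nonneg fun t => ?_
    have e : ∀ k, ‖(g k : ℂ)‖ ^ 2 = S * ∑ i ∈ s, ‖x i k‖ ^ 2 / l2Norm (x i) := fun k => by
      rw [Complex.norm_real, Real.norm_eq_abs, sq_abs, Real.sq_sqrt]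
      exact mul_nonneg hX.nonneg (Finset.sum_nonneg fun i _ =>
        div_nonneg (by positivity) (l2Norm_nonneg _))
    simp only [e]
    rw [← Finset.mul_sum, Finset.sum_comm, sq]
    refine mul_le_mul_of_nonneg_left (Finset.sum_le_sum fun i hi => ?_) hX.nonneg
    rw [← Finset.sum_div]
    refine div_le_of_le_mul₀ (l2Norm_nonneg _) (l2Norm_nonneg _) ?_
    rw [← sq]
    exact sum_norm_sq_le (hx i hi) t
  let m : ℕ → ℂ := fun k => kaltonFun α (Real.log (S / w k))
  have h1 : HasL2Bound (∑ i ∈ s, kaltonMap α (x i) - X * m) (kaltonLip α * (S + 2 * S)) := by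
    have hwg : HasL2Bound (fun k => ((w k + 2 * g k : ℝ) : ℂ)) (S + 2 * S) := by
      refine (hw.add (hg.of_norm_le_mul (x := fun k => ((2 * g k : ℝ) : ℂ)) zero_le_two
        fun k => ?_)).of_norm_le fun k => ?_
      · simp
      · simp
    refine hwg.of_norm_le_mul hκ fun k => ?_
    have hk0 : 0 ≤ w k + 2 * g k := add_nonneg (hw0 k) (mul_nonneg zero_le_two
      (Real.sqrt_nonneg _))
    rw [Complex.norm_real, Real.norm_of_nonneg hk0]
    have e : (∑ i ∈ s, kaltonMap α (x i) - X * m) k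
        = ∑ i ∈ s, x i k * (kaltonFun α (Real.log (l2Norm (x i) / ‖x i k‖)) - m k) := by
      simp only [kaltonMap_eq_scaledMap, hXdef, Pi.sub_apply, Finset.sum_apply, Pi.mul_apply,
        Finset.sum_mul, mul_sub, Finset.sum_sub_distrib, scaledMap]
    rw [e]
    refine (norm_sum_le _ _).trans ?_
    have hs := sum_mul_abs_log_sub_log_le s (fun i => ‖x i k‖) (fun i => l2Norm (x i))
      (fun i _ => norm_nonneg _) (fun i hi => norm_le_l2Norm (hx i hi) k)
    refine le_trans ?_ (mul_le_mul_of_nonneg_left hs hκ)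
    rw [Finset.mul_sum]
    refine Finset.sum_le_sum fun i hi => ?_
    rw [norm_mul, mul_left_comm]
    exact mul_le_mul_of_nonneg_left (kaltonFun_lipschitz α
      (log_div_norm_nonneg (norm_le_l2Norm (hx i hi) k)) (hwlog k)) (norm_nonneg _)
  have h2 : HasL2Bound (scaledMap α S X - X * m) (kaltonLip α * S) := by
    refine hw.of_norm_le_mul hκ fun k => ?_
    rw [Complex.norm_real, Real.norm_of_nonneg (hw0 k)]
    simp only [scaledMap, Pi.sub_apply, Pi.mul_apply, ← mul_sub, norm_mul]
    have hXw : ‖X k‖ ≤ w k := by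
      simpa [hXdef] using norm_sum_le s fun i => x i k
    rcases eq_or_ne (X k) 0 with h0 | h0
    · rw [h0, norm_zero, zero_mul]
      exact mul_nonneg hκ (hw0 k)
    have h0' := norm_pos_iff.2 h0
    have hwk : 0 < w k := h0'.trans_le hXw
    have hS : 0 < S := hwk.trans_le (hwS k)
    have hr : 1 ≤ w k / ‖X k‖ := (one_le_div h0').2 hXw
    have e : |Real.log (S / ‖X k‖) - Real.log (S / w k)| = Real.log (w k / ‖X k‖) := by
      rw [← abs_of_nonneg (Real.log_nonneg hr), ← Real.log_div (by positivity) (by positivity)]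
      congr 2
      field_simp
    have h3 := kaltonFun_lipschitz α (log_div_norm_nonneg (hX.norm_le k)) (hwlog k)
    rw [e] at h3
    calc _ ≤ ‖X k‖ * (kaltonLip α * (w k / ‖X k‖)) := by
          refine mul_le_mul_of_nonneg_left (h3.trans ?_) (norm_nonneg _)
          exact mul_le_mul_of_nonneg_left (Real.log_le_self (by positivity)) hκ
      _ = kaltonLip α * w k := by field_simp
  convert ((h1.sub h2).sub (kaltonMap_sub_scaledMap α hX)) using 1
  · abel
  · ring

/-! ### Linear maps on Kalton's space -/

variable {α : ℝ}

namespace kaltonSpace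

theorem hasL2Bound_fst (z : kaltonSpace α) : HasL2Bound z.1.1 (l2Norm z.1.1) :=
  z.2.1.hasL2Bound

theorem l2Norm_fst_le (z : kaltonSpace α) : l2Norm z.1.1 ≤ kaltonQuasiNorm α z :=
  le_add_of_nonneg_right (l2Norm_nonneg _)

theorem l2Norm_snd_le (z : kaltonSpace α) :
    l2Norm (z.1.2 - kaltonMap α z.1.1) ≤ kaltonQuasiNorm α z :=
  le_add_of_nonneg_left (l2Norm_nonneg _)

theorem quasiNorm_nonneg (z : kaltonSpace α) : 0 ≤ kaltonQuasiNorm α z :=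
  add_nonneg (l2Norm_nonneg _) (l2Norm_nonneg _)

theorem quasiNorm_smul (c : ℂ) (z : kaltonSpace α) :
    kaltonQuasiNorm α (c • z) = ‖c‖ * kaltonQuasiNorm α z := by
  simp only [kaltonQuasiNorm, Submodule.coe_smul, Prod.smul_fst, Prod.smul_snd, kaltonMap_smul,
    ← smul_sub, l2Norm_smul, mul_add]

theorem eq_zero_of_quasiNorm_eq_zero {z : kaltonSpace α} (h : kaltonQuasiNorm α z = 0) :
    z = 0 := by
  have h1 : l2Norm z.1.1 = 0 := le_antisymm (h ▸ l2Norm_fst_le z) (l2Norm_nonneg _)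
  have h2 : l2Norm (z.1.2 - kaltonMap α z.1.1) = 0 :=
    le_antisymm (h ▸ l2Norm_snd_le z) (l2Norm_nonneg _)
  have h3 := l2Norm_eq_zero z.2.1 h1
  have h4 := l2Norm_eq_zero z.2.2 h2
  rw [h3, kaltonMap_eq_scaledMap, sub_eq_zero] at h4
  refine Subtype.ext (Prod.ext h3 (h4.trans ?_))
  funext k
  simp [scaledMap]

/-- A pair that is close to the graph of Kalton's map with prescribed normalization. -/
theorem mem_of_scaledMap {x y : ℕ → ℂ} {C D : ℝ} (hx : HasL2Bound x C)
    (hy : HasL2Bound (y - scaledMap α C x) D) :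
    ∃ h : (x, y) ∈ kaltonSpace α, kaltonQuasiNorm α ⟨(x, y), h⟩ ≤ C + (D + kaltonLip α * C) := by
  have h2 : HasL2Bound (y - kaltonMap α x) (D + kaltonLip α * C) := by
    convert hy.sub (kaltonMap_sub_scaledMap α hx) using 1
    abel
  exact ⟨⟨hx.mem, h2.mem⟩, add_le_add hx.le h2.le⟩

theorem hasL2Bound_snd_sub_scaledMap (z : kaltonSpace α) {C : ℝ} (h : kaltonQuasiNorm α z ≤ C) :
    HasL2Bound (z.1.2 - scaledMap α C z.1.1) ((1 + kaltonLip α) * C) := by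
  have h1 : HasL2Bound z.1.1 C := ⟨z.2.1, (l2Norm_fst_le z).trans h⟩
  have h2 : HasL2Bound (z.1.2 - kaltonMap α z.1.1) C := ⟨z.2.2, (l2Norm_snd_le z).trans h⟩
  convert h2.add (kaltonMap_sub_scaledMap α h1) using 1
  · abel
  · ring

theorem norm_fst_apply_le (z : kaltonSpace α) (k : ℕ) : ‖z.1.1 k‖ ≤ kaltonQuasiNorm α z :=
  (norm_le_l2Norm z.2.1 k).trans (l2Norm_fst_le z)

theorem norm_snd_apply_le (z : kaltonSpace α) (k : ℕ) : ‖z.1.2 k‖ ≤ kaltonQuasiNorm α z := by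
  have h1 := norm_le_l2Norm z.2.2 k
  have h2 := norm_kaltonMap_le α z.2.1 k
  calc ‖z.1.2 k‖ = ‖kaltonMap α z.1.1 k + (z.1.2 - kaltonMap α z.1.1) k‖ := by simp
    _ ≤ _ := (norm_add_le _ _).trans (add_le_add h2 h1)

/-- The constant in the generalized triangle inequality for the quasi-norm of `Z_α`. -/
noncomputable def triangleConst (α : ℝ) : ℝ := 1 + 5 * kaltonLip α

theorem one_le_triangleConst (α : ℝ) : 1 ≤ triangleConst α := by
  have := kaltonLip_nonneg α
  rw [triangleConst]
  linarith

theorem quasiNorm_sum_le {ι : Type*} (s : Finset ι) (z : ι → kaltonSpace α) :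
    kaltonQuasiNorm α (∑ i ∈ s, z i) ≤ triangleConst α * ∑ i ∈ s, kaltonQuasiNorm α (z i) := by
  have h1 : (∑ i ∈ s, z i).1.1 = ∑ i ∈ s, (z i).1.1 := by
    simp [Prod.fst_sum]
  have h2 : (∑ i ∈ s, z i).1.2 = ∑ i ∈ s, (z i).1.2 := by
    simp [Prod.snd_sum]
  have hx := HasL2Bound.sum s fun i _ => hasL2Bound_fst (z i)
  have hy := HasL2Bound.sum s fun i _ => (z i).2.2.hasL2Bound
  have hq := sum_kaltonMap_sub_kaltonMap_sum α s fun i _ => (z i).2.1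
  have hle := (hy.add hq).le
  rw [Finset.sum_sub_distrib, ← add_sub_assoc, sub_add_cancel] at hle
  rw [kaltonQuasiNorm, h1, h2]
  have hle2 : ∑ i ∈ s, l2Norm (z i).1.1 ≤ ∑ i ∈ s, kaltonQuasiNorm α (z i) :=
    Finset.sum_le_sum fun i _ => l2Norm_fst_le (z i)
  have h5 : ∑ i ∈ s, kaltonQuasiNorm α (z i) = ∑ i ∈ s, l2Norm (z i).1.1
      + ∑ i ∈ s, l2Norm ((z i).1.2 - kaltonMap α (z i).1.1) := Finset.sum_add_distrib
  have := mul_le_mul_of_nonneg_left hle2 (mul_nonneg (by norm_num : (0 : ℝ) ≤ 5)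
    (kaltonLip_nonneg α))
  rw [triangleConst, add_mul, one_mul]
  linarith [hx.le]

theorem quasiNorm_add_le (z z' : kaltonSpace α) :
    kaltonQuasiNorm α (z + z')
      ≤ triangleConst α * (kaltonQuasiNorm α z + kaltonQuasiNorm α z') := by
  simpa using quasiNorm_sum_le Finset.univ ![z, z']

end kaltonSpace

/-- A linear operator on sequences that acts boundedly on `ℓ₂` and almost commutes with Kalton's
map, with respective bounds `C` and `D`. -/
structure IsKaltonBounded (α : ℝ) (P : (ℕ → ℂ) →ₗ[ℂ] (ℕ → ℂ)) (C D : ℝ) : Prop where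
  map : ∀ x, Memℓp x 2 → HasL2Bound (P x) (C * l2Norm x)
  comm : ∀ x, Memℓp x 2 → HasL2Bound (P (kaltonMap α x) - kaltonMap α (P x)) (D * l2Norm x)

namespace IsKaltonBounded

variable {P : (ℕ → ℂ) →ₗ[ℂ] (ℕ → ℂ)} {C D : ℝ}

theorem snd_sub (hP : IsKaltonBounded α P C D) (z : kaltonSpace α) :
    HasL2Bound (P z.1.2 - kaltonMap α (P z.1.1))
      (C * l2Norm (z.1.2 - kaltonMap α z.1.1) + D * l2Norm z.1.1) := by
  have := (hP.map _ z.2.2).add (hP.comm _ z.2.1)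
  rwa [map_sub, ← add_sub_assoc, sub_add_cancel] at this

/-- The operator `(x, y) ↦ (P x, P y)` on `Z_α`. -/
noncomputable def lift (hP : IsKaltonBounded α P C D) : kaltonSpace α →ₗ[ℂ] kaltonSpace α :=
  (P.prodMap P).restrict fun z hz => ⟨(hP.map _ hz.1).mem, (hP.snd_sub ⟨z, hz⟩).mem⟩

@[simp] theorem lift_fst (hP : IsKaltonBounded α P C D) (z : kaltonSpace α) :
    (hP.lift z).1.1 = P z.1.1 := rfl

@[simp] theorem lift_snd (hP : IsKaltonBounded α P C D) (z : kaltonSpace α) :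
    (hP.lift z).1.2 = P z.1.2 := rfl

theorem quasiNorm_lift_le (hP : IsKaltonBounded α P C D) (hD : 0 ≤ D) (z : kaltonSpace α) :
    kaltonQuasiNorm α (hP.lift z) ≤ (C + D) * kaltonQuasiNorm α z := by
  have h1 := (hP.map _ z.2.1).le
  have h2 := (hP.snd_sub z).le
  have h3 := mul_nonneg hD (l2Norm_nonneg (z.1.2 - kaltonMap α z.1.1))
  simp only [kaltonQuasiNorm, lift_fst, lift_snd]
  linarith

end IsKaltonBounded

/-- Multiplication by a sequence. -/
noncomputable def mulSeq (μ : ℕ → ℂ) : (ℕ → ℂ) →ₗ[ℂ] (ℕ → ℂ) := LinearMap.mulLeft ℂ μ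

@[simp] theorem mulSeq_apply (μ x : ℕ → ℂ) (k : ℕ) : mulSeq μ x k = μ k * x k := rfl

theorem isKaltonBounded_mulSeq (α : ℝ) {μ : ℕ → ℂ} (hμ : ∀ k, ‖μ k‖ ≤ 1) :
    IsKaltonBounded α (mulSeq μ) 1 (2 * kaltonLip α) where
  map x hx := hx.hasL2Bound.of_norm_le_mul zero_le_one fun k => by
    rw [mulSeq_apply, norm_mul]
    exact mul_le_mul_of_nonneg_right (hμ k) (norm_nonneg _)
  comm x hx := by
    have hμx : ∀ k, ‖mulSeq μ x k‖ ≤ ‖x k‖ := fun k => by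
      rw [mulSeq_apply, norm_mul]
      exact mul_le_of_le_one_left (norm_nonneg _) (hμ k)
    have h1 : HasL2Bound (mulSeq μ x) (l2Norm x) := hx.hasL2Bound.of_norm_le hμx
    have h2 : HasL2Bound (mulSeq μ (kaltonMap α x) - scaledMap α (l2Norm x) (mulSeq μ x))
        (kaltonLip α * l2Norm x) := by
      refine hx.hasL2Bound.of_norm_le_mul (kaltonLip_nonneg α) fun k => ?_
      rw [kaltonMap_eq_scaledMap]
      simp only [Pi.sub_apply, mulSeq_apply, scaledMap]
      rcases eq_or_ne (x k) 0 with hk | hk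
      · simp [hk]
      rcases eq_or_ne (μ k) 0 with hm | hm
      · simp only [hm, zero_mul, sub_zero, norm_zero]
        exact mul_nonneg (kaltonLip_nonneg α) (norm_nonneg _)
      have hk' := norm_pos_iff.2 hk
      have hm' := norm_pos_iff.2 hm
      have hS : 0 < l2Norm x := hk'.trans_le (norm_le_l2Norm hx k)
      have hl := kaltonFun_lipschitz α (log_div_norm_nonneg (norm_le_l2Norm hx k))
        (log_div_norm_nonneg (h1.norm_le k))
      have e : |Real.log (l2Norm x / ‖x k‖) - Real.log (l2Norm x / ‖mulSeq μ x k‖)|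
          = Real.log (1 / ‖μ k‖) := by
        rw [← abs_of_nonneg (Real.log_nonneg ((one_le_div hm').2 (hμ k))), abs_sub_comm,
          mulSeq_apply, norm_mul, ← Real.log_div (by positivity) (by positivity)]
        congr 2
        field_simp
      rw [e, mulSeq_apply, norm_mul (μ k)] at hl
      rw [← mul_assoc, ← mul_sub, norm_mul, norm_mul]
      calc _ ≤ ‖μ k‖ * ‖x k‖ * (kaltonLip α * (1 / ‖μ k‖)) := by
            refine mul_le_mul_of_nonneg_left (hl.trans ?_) (by positivity)
            exact mul_le_mul_of_nonneg_left (Real.log_le_self (by positivity))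
              (kaltonLip_nonneg α)
        _ = _ := by field_simp
    convert h2.sub (kaltonMap_sub_scaledMap α h1) using 1
    · abel
    · ring

theorem isKaltonBounded_funLeft (α : ℝ) {e : ℕ → ℕ} (he : Function.Injective e) :
    IsKaltonBounded α (LinearMap.funLeft ℂ ℂ e) 1 (kaltonLip α) where
  map x hx := by
    rw [one_mul]
    exact hx.hasL2Bound.comp he
  comm x hx := by
    have h := (kaltonMap_sub_scaledMap α (hx.hasL2Bound.comp he)).neg
    rw [neg_sub] at h
    rw [kaltonMap_eq_scaledMap α x]
    exact h

theorem l2Norm_extend {e : ℕ → ℕ} (he : Function.Injective e) (x : ℕ → ℂ) :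
    l2Norm (Function.extend e x 0) = l2Norm x := by
  rw [l2Norm, l2Norm]
  have : (fun k => ‖Function.extend e x 0 k‖ ^ 2) = Function.extend e (fun k => ‖x k‖ ^ 2) 0 := by
    funext k
    by_cases h : ∃ j, e j = k
    · obtain ⟨j, rfl⟩ := h
      simp [he.extend_apply]
    · simp [Function.extend_apply' _ _ _ h]
  rw [this, tsum_extend_zero he]

theorem Memℓp.extend {e : ℕ → ℕ} (he : Function.Injective e) {x : ℕ → ℂ} (hx : Memℓp x 2) :
    Memℓp (Function.extend e x 0) 2 := by
  rw [memLp_two_iff] at hx ⊢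
  have : (fun k => ‖Function.extend e x 0 k‖ ^ 2) = Function.extend e (fun k => ‖x k‖ ^ 2) 0 := by
    funext k
    by_cases h : ∃ j, e j = k
    · obtain ⟨j, rfl⟩ := h
      simp [he.extend_apply]
    · simp [Function.extend_apply' _ _ _ h]
  rw [this]
  exact (summable_extend_zero he).2 hx

theorem isKaltonBounded_extendByZero (α : ℝ) {e : ℕ → ℕ} (he : Function.Injective e) :
    IsKaltonBounded α (Function.ExtendByZero.linearMap ℂ e) 1 0 where
  map x hx := by
    rw [one_mul, ← l2Norm_extend he x]
    exact (hx.extend he).hasL2Bound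
  comm x hx := by
    have : Function.extend e (kaltonMap α x) 0 = kaltonMap α (Function.extend e x 0) := by
      rw [kaltonMap_eq_scaledMap, kaltonMap_eq_scaledMap, l2Norm_extend he]
      funext k
      by_cases h : ∃ j, e j = k
      · obtain ⟨j, rfl⟩ := h
        simp [he.extend_apply, scaledMap]
      · simp [Function.extend_apply' _ _ _ h, scaledMap]
    rw [zero_mul]
    change HasL2Bound (Function.extend e (kaltonMap α x) 0
      - kaltonMap α (Function.extend e x 0)) 0
    rw [this, sub_self]
    exact HasL2Bound.zero

/-! ### The operators factoring over Kalton's space form an operator ideal -/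

theorem kaltonSpace.exists_fst_apply_zero_eq_one (α : ℝ) :
    ∃ z : kaltonSpace α, z.1.1 0 = 1 := by
  have h : HasL2Bound (Pi.single 0 1 : ℕ → ℂ) 1 :=
    HasL2Bound.of_sum_sq_le zero_le_one fun s => by
      have : ∀ k, ‖(Pi.single 0 1 : ℕ → ℂ) k‖ ^ 2 = if k = 0 then 1 else 0 := fun k => by
        rcases eq_or_ne k 0 with rfl | hk
        · simp
        · simp [hk]
      simp only [this]
      rw [Finset.sum_ite_eq' s]
      split_ifs <;> norm_num
  obtain ⟨hz, -⟩ := kaltonSpace.mem_of_scaledMap (α := α)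
    (y := scaledMap α 1 (Pi.single 0 1)) (D := 0) h (by
      rw [sub_self]
      exact HasL2Bound.zero)
  exact ⟨⟨_, hz⟩, by simp⟩

theorem exists_nonneg_bound {ι : Type*} {f g : ι → ℝ} (hg : ∀ i, 0 ≤ g i)
    (h : ∃ C : ℝ, ∀ i, f i ≤ C * g i) : ∃ C : ℝ, 0 ≤ C ∧ ∀ i, f i ≤ C * g i := by
  obtain ⟨C, hC⟩ := h
  exact ⟨max C 0, le_max_right _ _, fun i => (hC i).trans
    (mul_le_mul_of_nonneg_right (le_max_left _ _) (hg i))⟩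

/-- Sums are formed with the help of the decomposition of `Z_α` into the pairs of sequences
supported by the even and by the odd numbers, both of which are copies of `Z_α`. -/
theorem isOperatorIdeal_kaltonIdeal (α : ℝ) : IsOperatorIdeal (kaltonIdeal.{u} α) where
  rankOne_mem := by
    intro X Y _ _ _ _ _ _ φ y
    obtain ⟨z, hz⟩ := kaltonSpace.exists_fst_apply_zero_eq_one α
    let p : kaltonSpace α →ₗ[ℂ] ℂ :=
      (LinearMap.proj 0 ∘ₗ LinearMap.fst ℂ (ℕ → ℂ) (ℕ → ℂ)) ∘ₗ (kaltonSpace α).subtype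
    have hp : ∀ w, p w = w.1.1 0 := fun w => rfl
    refine ⟨φ.toLinearMap.smulRight z, p.smulRight y, ⟨‖φ‖ * kaltonQuasiNorm α z, fun x => ?_⟩,
      ⟨‖y‖, fun w => ?_⟩, fun x => ?_⟩
    · rw [LinearMap.smulRight_apply, kaltonSpace.quasiNorm_smul]
      calc _ ≤ ‖φ‖ * ‖x‖ * kaltonQuasiNorm α z :=
            mul_le_mul_of_nonneg_right (φ.le_opNorm x) (kaltonSpace.quasiNorm_nonneg z)
        _ = _ := by ring
    · rw [LinearMap.smulRight_apply, norm_smul, mul_comm]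
      exact mul_le_mul_of_nonneg_left (kaltonSpace.norm_fst_apply_le w 0) (norm_nonneg _)
    · simp [hp, hz]
  add_mem := by
    rintro X Y _ _ _ _ _ _ S T ⟨A₁, B₁, hA₁, hB₁, h₁⟩ ⟨A₂, B₂, hA₂, hB₂, h₂⟩
    obtain ⟨a₁, ha₁, hA₁⟩ := exists_nonneg_bound (fun x => norm_nonneg x) hA₁
    obtain ⟨a₂, ha₂, hA₂⟩ := exists_nonneg_bound (fun x => norm_nonneg x) hA₂
    obtain ⟨b₁, hb₁, hB₁⟩ := exists_nonneg_bound kaltonSpace.quasiNorm_nonneg hB₁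
    obtain ⟨b₂, hb₂, hB₂⟩ := exists_nonneg_bound kaltonSpace.quasiNorm_nonneg hB₂
    have he : Function.Injective fun k : ℕ => 2 * k := fun i j h => by
      simp only at h
      omega
    have ho : Function.Injective fun k : ℕ => 2 * k + 1 := fun i j h => by
      simp only at h
      omega
    have hJe := isKaltonBounded_extendByZero α he
    have hJo := isKaltonBounded_extendByZero α ho
    have hPe := isKaltonBounded_funLeft α he
    have hPo := isKaltonBounded_funLeft α ho
    have hκ := kaltonLip_nonneg α
    have hK := zero_le_one.trans (kaltonSpace.one_le_triangleConst α)
    refine ⟨hJe.lift ∘ₗ A₁ + hJo.lift ∘ₗ A₂, B₁ ∘ₗ hPe.lift + B₂ ∘ₗ hPo.lift,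
      ⟨kaltonSpace.triangleConst α * (a₁ + a₂), fun x => ?_⟩,
      ⟨(b₁ + b₂) * (1 + kaltonLip α), fun z => ?_⟩, fun x => ?_⟩
    · have h1 := hJe.quasiNorm_lift_le le_rfl (A₁ x)
      have h2 := hJo.quasiNorm_lift_le le_rfl (A₂ x)
      refine (kaltonSpace.quasiNorm_add_le _ _).trans ?_
      rw [mul_assoc]
      refine mul_le_mul_of_nonneg_left ?_ hK
      simp only [LinearMap.comp_apply]
      linarith [hA₁ x, hA₂ x]
    · have h1 := mul_le_mul_of_nonneg_left (hPe.quasiNorm_lift_le hκ z) hb₁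
      have h2 := mul_le_mul_of_nonneg_left (hPo.quasiNorm_lift_le hκ z) hb₂
      refine (norm_add_le _ _).trans ?_
      simp only [LinearMap.comp_apply]
      linarith [hB₁ (hPe.lift z), hB₂ (hPo.lift z)]
    · have hee : ∀ x : ℕ → ℂ, LinearMap.funLeft ℂ ℂ (fun k : ℕ => 2 * k)
          (Function.ExtendByZero.linearMap ℂ (fun k : ℕ => 2 * k) x) = x := fun x => by
        funext k
        exact he.extend_apply x 0 k
      have hoo : ∀ x : ℕ → ℂ, LinearMap.funLeft ℂ ℂ (fun k : ℕ => 2 * k + 1)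
          (Function.ExtendByZero.linearMap ℂ (fun k : ℕ => 2 * k + 1) x) = x := fun x => by
        funext k
        exact ho.extend_apply x 0 k
      have heo : ∀ x : ℕ → ℂ, LinearMap.funLeft ℂ ℂ (fun k : ℕ => 2 * k)
          (Function.ExtendByZero.linearMap ℂ (fun k : ℕ => 2 * k + 1) x) = 0 := fun x => by
        funext k
        exact Function.extend_apply' _ _ _ fun ⟨j, hj⟩ => by
          simp only at hj
          omega
      have hoe : ∀ x : ℕ → ℂ, LinearMap.funLeft ℂ ℂ (fun k : ℕ => 2 * k + 1)
          (Function.ExtendByZero.linearMap ℂ (fun k : ℕ => 2 * k) x) = 0 := fun x => by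
        funext k
        exact Function.extend_apply' _ _ _ fun ⟨j, hj⟩ => by
          simp only at hj
          omega
      have e1 : hPe.lift (hJe.lift (A₁ x) + hJo.lift (A₂ x)) = A₁ x :=
        Subtype.ext (Prod.ext (by simp [hee, heo]) (by simp [hee, heo]))
      have e2 : hPo.lift (hJe.lift (A₁ x) + hJo.lift (A₂ x)) = A₂ x :=
        Subtype.ext (Prod.ext (by simp [hoo, hoe]) (by simp [hoo, hoe]))
      simp only [add_apply, LinearMap.add_apply, LinearMap.comp_apply, e1, e2,
        h₁, h₂]
  comp_mem := by
    rintro W X Y Z _ _ _ _ _ _ _ _ _ _ _ _ R S T ⟨A, B, hA, hB, h⟩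
    obtain ⟨a, ha, hA⟩ := exists_nonneg_bound (fun x => norm_nonneg x) hA
    obtain ⟨b, hb, hB⟩ := exists_nonneg_bound kaltonSpace.quasiNorm_nonneg hB
    refine ⟨A ∘ₗ R.toLinearMap, T.toLinearMap ∘ₗ B, ⟨a * ‖R‖, fun x => ?_⟩,
      ⟨‖T‖ * b, fun z => ?_⟩, fun x => ?_⟩
    · refine (hA (R x)).trans ?_
      rw [mul_assoc]
      exact mul_le_mul_of_nonneg_left (R.le_opNorm x) ha
    · refine (T.le_opNorm (B z)).trans ?_
      rw [mul_assoc]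
      exact mul_le_mul_of_nonneg_left (hB z) (norm_nonneg _)
    · simp [h]

/-! ### Kalton's space is a Banach space -/

theorem HasL2Bound.of_tendsto {x : ℕ → ℕ → ℂ} {a : ℕ → ℂ} {C : ℝ}
    (h : ∀ m, HasL2Bound (x m) C)
    (hx : ∀ k, Filter.Tendsto (fun m => x m k) Filter.atTop (nhds (a k))) : HasL2Bound a C :=
  HasL2Bound.of_sum_sq_le (h 0).nonneg fun s =>
    le_of_tendsto' (tendsto_finsetSum s fun k _ => ((hx k).norm.pow 2))
      fun m => (h m).sum_sq_le s

theorem tendsto_scaledMap (α : ℝ) {x : ℕ → ℕ → ℂ} {a : ℕ → ℂ} {C : ℝ} {k : ℕ}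
    (h : ∀ m, ‖x m k‖ ≤ C)
    (hx : Filter.Tendsto (fun m => x m k) Filter.atTop (nhds (a k))) :
    Filter.Tendsto (fun m => scaledMap α C (x m) k) Filter.atTop (nhds (scaledMap α C a k)) := by
  rcases eq_or_ne (a k) 0 with h0 | h0
  · have hb : ∀ m, ‖scaledMap α C (x m) k‖ ≤ 2 * √(C * ‖x m k‖) := fun m => by
      have hC := (norm_nonneg _).trans (h m)
      rcases eq_or_ne (x m k) 0 with hk | hk
      · simp [scaledMap, hk]
      have hk' := norm_pos_iff.2 hk
      have hC' := hk'.trans_le (h m)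
      rw [scaledMap, norm_mul, norm_kaltonFun α (log_div_norm_nonneg (h m))]
      have e : Real.log (C / ‖x m k‖) = 2 * Real.log √(C / ‖x m k‖) := by
        rw [Real.log_sqrt (by positivity)]
        ring
      have e2 : √(C * ‖x m k‖) = ‖x m k‖ * √(C / ‖x m k‖) := by
        conv_rhs => rw [← Real.sqrt_sq hk'.le]
        rw [← Real.sqrt_mul (by positivity), Real.sqrt_sq hk'.le]
        congr 1
        field_simp
      rw [e, e2]
      have := mul_le_mul_of_nonneg_left (Real.log_le_self (Real.sqrt_nonneg (C / ‖x m k‖)))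
        hk'.le
      linarith
    have hlim : Filter.Tendsto (fun m => 2 * √(C * ‖x m k‖)) Filter.atTop (nhds 0) := by
      have := ((hx.norm.const_mul C).sqrt).const_mul 2
      simpa [h0] using this
    have : scaledMap α C a k = 0 := by simp [scaledMap, h0]
    rw [this]
    exact squeeze_zero_norm hb hlim
  · rcases ((norm_nonneg _).trans (h 0)).eq_or_lt with hC | hC
    · simp [scaledMap, ← hC, kaltonFun_zero]
    · have h1 : Filter.Tendsto (fun m => C / ‖x m k‖) Filter.atTop (nhds (C / ‖a k‖)) :=
        tendsto_const_nhds.div hx.norm (norm_ne_zero_iff.2 h0)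
      have h2 := h1.log (div_pos hC (norm_pos_iff.2 h0)).ne'
      exact hx.mul (((continuous_kaltonFun α).tendsto _).comp h2)

section Renorming

open scoped Pointwise

variable {E : Type*} [AddCommGroup E] [Module ℂ E] {q : E → ℝ}

theorem apply_real_smul (hq : ∀ (c : ℂ) z, q (c • z) = ‖c‖ * q z) (r : ℝ) (z : E) :
    q (r • z) = |r| * q z := by
  rw [← Complex.coe_smul, hq, Complex.norm_real, Real.norm_eq_abs]

theorem mem_smul_convexHull (hq : ∀ (c : ℂ) z, q (c • z) = ‖c‖ * q z) {z : E} {r : ℝ}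
    (hr : r ≠ 0) (h : q z ≤ |r|) : z ∈ r • convexHull ℝ {z | q z ≤ 1} := by
  refine (Set.mem_smul_set_iff_inv_smul_mem₀ hr _ _).2 (subset_convexHull ℝ _ ?_)
  rw [Set.mem_ofPred_eq, apply_real_smul hq, abs_inv, inv_mul_le_iff₀ (abs_pos.2 hr), mul_one]
  exact h

theorem balanced_convexHull_of_homogeneous (h0 : ∀ z, 0 ≤ q z)
    (hq : ∀ (c : ℂ) z, q (c • z) = ‖c‖ * q z) : Balanced ℂ (convexHull ℝ {z | q z ≤ 1}) := by
  refine balanced_iff_smul_mem.2 fun c hc z hz => ?_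
  refine convexHull_min (t := {z | c • z ∈ convexHull ℝ {z | q z ≤ 1}}) (fun v hv => ?_) ?_ hz
  · refine subset_convexHull ℝ _ ?_
    rw [Set.mem_ofPred_eq] at hv ⊢
    rw [hq]
    exact (mul_le_of_le_one_left (h0 v) hc).trans hv
  · intro v hv w hw s t hs ht hst
    rw [Set.mem_ofPred_eq] at hv hw ⊢
    rw [smul_add, smul_comm c s, smul_comm c t]
    exact convex_convexHull ℝ _ hv hw hs ht hst

theorem absorbent_convexHull_of_homogeneous (h0 : ∀ z, 0 ≤ q z)
    (hq : ∀ (c : ℂ) z, q (c • z) = ‖c‖ * q z) : Absorbent ℝ (convexHull ℝ {z | q z ≤ 1}) := by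
  intro z
  filter_upwards [eventually_cobounded_le_norm (E := ℝ) (q z + 1)] with r hr
  rw [Real.norm_eq_abs] at hr
  have := h0 z
  exact Set.singleton_subset_iff.2
    (mem_smul_convexHull hq (abs_pos.1 (by linarith)) (by linarith))

/-- The seminorm whose unit ball is the convex hull of `{z | q z ≤ 1}`. -/
noncomputable def hullGauge (h0 : ∀ z, 0 ≤ q z) (hq : ∀ (c : ℂ) z, q (c • z) = ‖c‖ * q z) :
    Seminorm ℂ E :=
  gaugeSeminorm (balanced_convexHull_of_homogeneous h0 hq) (convex_convexHull ℝ _)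
    (absorbent_convexHull_of_homogeneous h0 hq)

theorem hullGauge_le (h0 : ∀ z, 0 ≤ q z) (hq : ∀ (c : ℂ) z, q (c • z) = ‖c‖ * q z) (z : E) :
    hullGauge h0 hq z ≤ q z := by
  refine le_of_forall_pos_le_add fun ε hε => ?_
  have := add_pos_of_nonneg_of_pos (h0 z) hε
  exact gauge_le_of_mem this.le (mem_smul_convexHull hq this.ne' (by
    rw [abs_of_pos this]
    linarith))

/-- A homogeneous functional that satisfies the generalized triangle inequality with a constant
independent of the number of summands is equivalent to a seminorm. -/
theorem le_mul_hullGauge (h0 : ∀ z, 0 ≤ q z) (hq : ∀ (c : ℂ) z, q (c • z) = ‖c‖ * q z) {K : ℝ}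
    (hK : 0 < K) (hsum : ∀ {ι : Type} (s : Finset ι) (v : ι → E),
      q (∑ i ∈ s, v i) ≤ K * ∑ i ∈ s, q (v i)) (z : E) :
    q z ≤ K * hullGauge h0 hq z := by
  have hull : ∀ v ∈ convexHull ℝ {z | q z ≤ 1}, q v ≤ K := fun v hv => by
    rw [convexHull_eq] at hv
    obtain ⟨ι, t, w, v, hw, hw1, hv, rfl⟩ := hv
    rw [Finset.centerMass_eq_of_sum_1 _ _ hw1]
    refine (hsum t _).trans (mul_le_of_le_one_right hK.le ?_)
    rw [← hw1]
    refine Finset.sum_le_sum fun i hi => ?_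
    rw [apply_real_smul hq, abs_of_nonneg (hw i hi)]
    exact mul_le_of_le_one_right (hw i hi) (hv i hi)
  by_contra! hlt
  rw [← lt_div_iff₀' hK] at hlt
  obtain ⟨b, hb, hbr, hz⟩ := exists_lt_of_gauge_lt (absorbent_convexHull_of_homogeneous h0 hq) hlt
  have h := hull _ ((Set.mem_smul_set_iff_inv_smul_mem₀ hb.ne' _ _).1 hz)
  rw [apply_real_smul hq, abs_of_pos (inv_pos.2 hb), inv_mul_le_iff₀ hb] at h
  exact h.not_gt ((lt_div_iff₀ hK).1 hbr)

theorem exists_seminorm_le_le_mul (h0 : ∀ z, 0 ≤ q z) (hq : ∀ (c : ℂ) z, q (c • z) = ‖c‖ * q z)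
    {K : ℝ} (hK : 0 < K) (hsum : ∀ {ι : Type} (s : Finset ι) (v : ι → E),
      q (∑ i ∈ s, v i) ≤ K * ∑ i ∈ s, q (v i)) :
    ∃ p : Seminorm ℂ E, ∀ z, p z ≤ q z ∧ q z ≤ K * p z :=
  ⟨hullGauge h0 hq, fun z => ⟨hullGauge_le h0 hq z, le_mul_hullGauge h0 hq hK hsum z⟩⟩

end Renorming

namespace kaltonSpace

/-- Balls of the quasi-norm are, up to a factor, closed under coordinatewise convergence. -/
theorem mem_of_tendsto {z : ℕ → kaltonSpace α} {C : ℝ} {x y : ℕ → ℂ}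
    (hz : ∀ m, kaltonQuasiNorm α (z m) ≤ C)
    (hx : ∀ k, Filter.Tendsto (fun m => (z m).1.1 k) Filter.atTop (nhds (x k)))
    (hy : ∀ k, Filter.Tendsto (fun m => (z m).1.2 k) Filter.atTop (nhds (y k))) :
    ∃ h : (x, y) ∈ kaltonSpace α,
      kaltonQuasiNorm α ⟨(x, y), h⟩ ≤ (2 + 2 * kaltonLip α) * C := by
  have hb : ∀ m, HasL2Bound (z m).1.1 C := fun m => ⟨(z m).2.1, (l2Norm_fst_le _).trans (hz m)⟩
  have h1 : HasL2Bound x C := HasL2Bound.of_tendsto hb hx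
  have h2 : HasL2Bound (y - scaledMap α C x) ((1 + kaltonLip α) * C) :=
    HasL2Bound.of_tendsto (fun m => hasL2Bound_snd_sub_scaledMap (z m) (hz m)) fun k =>
      (hy k).sub (tendsto_scaledMap α (fun m => (hb m).norm_le k) (hx k))
  obtain ⟨h, hle⟩ := mem_of_scaledMap h1 h2
  exact ⟨h, hle.trans_eq (by ring)⟩

end kaltonSpace

/-- Kalton's space as a Banach space in an arbitrary universe. -/
def KaltonBanach (α : ℝ) : Type u := ULift.{u} (kaltonSpace α)

namespace KaltonBanach

noncomputable instance : AddCommGroup (KaltonBanach.{u} α) :=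
  inferInstanceAs (AddCommGroup (ULift.{u} (kaltonSpace α)))

noncomputable instance : Module ℂ (KaltonBanach.{u} α) :=
  inferInstanceAs (Module ℂ (ULift.{u} (kaltonSpace α)))

/-- The identity from the Banach space to Kalton's space. -/
noncomputable def toKalton : KaltonBanach.{u} α ≃ₗ[ℂ] kaltonSpace α := ULift.moduleEquiv

theorem exists_equivalent_seminorm (α : ℝ) : ∃ p : Seminorm ℂ (KaltonBanach.{u} α),
    ∀ z, p z ≤ kaltonQuasiNorm α (toKalton z) ∧
      kaltonQuasiNorm α (toKalton z) ≤ kaltonSpace.triangleConst α * p z :=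
  exists_seminorm_le_le_mul (q := fun z => kaltonQuasiNorm α (toKalton z))
    (fun _ => kaltonSpace.quasiNorm_nonneg _)
    (fun c z => by rw [map_smul, kaltonSpace.quasiNorm_smul])
    (zero_lt_one.trans_le (kaltonSpace.one_le_triangleConst α))
    fun s v => by
      rw [map_sum]
      exact kaltonSpace.quasiNorm_sum_le s _

/-- A norm on `Z_α` that is equivalent to the quasi-norm. -/
noncomputable def convexNorm (α : ℝ) : Seminorm ℂ (KaltonBanach.{u} α) :=
  (exists_equivalent_seminorm α).choose

theorem convexNorm_le (z : KaltonBanach.{u} α) :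
    convexNorm α z ≤ kaltonQuasiNorm α (toKalton z) :=
  ((exists_equivalent_seminorm α).choose_spec z).1

theorem quasiNorm_le_convexNorm (z : KaltonBanach.{u} α) :
    kaltonQuasiNorm α (toKalton z) ≤ kaltonSpace.triangleConst α * convexNorm α z :=
  ((exists_equivalent_seminorm α).choose_spec z).2

noncomputable instance : NormedAddCommGroup (KaltonBanach.{u} α) :=
  AddGroupNorm.toNormedAddCommGroup
    { (convexNorm.{u} α).toAddGroupSeminorm with
      eq_zero_of_map_eq_zero' := fun z hz => by
        have h1 := quasiNorm_le_convexNorm z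
        have h2 : convexNorm α z = 0 := hz
        rw [h2, mul_zero] at h1
        exact (LinearEquiv.map_eq_zero_iff _).1 (kaltonSpace.eq_zero_of_quasiNorm_eq_zero
          (le_antisymm h1 (kaltonSpace.quasiNorm_nonneg _))) }

theorem norm_def (z : KaltonBanach.{u} α) : ‖z‖ = convexNorm α z := rfl

theorem norm_le (z : KaltonBanach.{u} α) : ‖z‖ ≤ kaltonQuasiNorm α (toKalton z) :=
  convexNorm_le _

theorem quasiNorm_le (z : KaltonBanach.{u} α) :
    kaltonQuasiNorm α (toKalton z) ≤ kaltonSpace.triangleConst α * ‖z‖ :=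
  quasiNorm_le_convexNorm _

noncomputable instance : NormedSpace ℂ (KaltonBanach.{u} α) where
  norm_smul_le c z := by
    rw [norm_def, norm_def, map_smul_eq_mul]

instance : CompleteSpace (KaltonBanach.{u} α) := by
  refine Metric.complete_of_cauchySeq_tendsto fun z hz => ?_
  have hK := zero_lt_one.trans_le (kaltonSpace.one_le_triangleConst α)
  have hκ := kaltonLip_nonneg α
  have hcauchy : ∀ ε > 0, ∃ N, ∀ n ≥ N, ∀ m ≥ N,
      kaltonQuasiNorm α (toKalton (z n) - toKalton (z m)) ≤ ε := fun ε hε => by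
    obtain ⟨N, hN⟩ := Metric.cauchySeq_iff.1 hz (ε / kaltonSpace.triangleConst α)
      (div_pos hε hK)
    refine ⟨N, fun n hn m hm => ?_⟩
    rw [← map_sub]
    refine (quasiNorm_le _).trans ?_
    rw [← dist_eq_norm, mul_comm]
    exact (le_div_iff₀ hK).1 (hN n hn m hm).le
  have hlim : ∀ f : kaltonSpace α →ₗ[ℂ] ℂ, (∀ w, ‖f w‖ ≤ kaltonQuasiNorm α w) →
      ∃ a, Filter.Tendsto (fun n => f (toKalton (z n))) Filter.atTop (nhds a) := fun f hf => by
    refine cauchySeq_tendsto_of_complete (Metric.cauchySeq_iff.2 fun ε hε => ?_)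
    obtain ⟨N, hN⟩ := hcauchy (ε / 2) (half_pos hε)
    refine ⟨N, fun n hn m hm => ?_⟩
    rw [dist_eq_norm, ← map_sub]
    linarith [(hf _).trans (hN n hn m hm)]
  have hx : ∀ k, ∃ a, Filter.Tendsto (fun n => (toKalton (z n)).1.1 k) Filter.atTop (nhds a) :=
    fun k => hlim ((LinearMap.proj k ∘ₗ LinearMap.fst ℂ (ℕ → ℂ) (ℕ → ℂ)) ∘ₗ
      (kaltonSpace α).subtype) fun w => kaltonSpace.norm_fst_apply_le w k
  have hy : ∀ k, ∃ a, Filter.Tendsto (fun n => (toKalton (z n)).1.2 k) Filter.atTop (nhds a) :=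
    fun k => hlim ((LinearMap.proj k ∘ₗ LinearMap.snd ℂ (ℕ → ℂ) (ℕ → ℂ)) ∘ₗ
      (kaltonSpace α).subtype) fun w => kaltonSpace.norm_snd_apply_le w k
  choose x hx using hx
  choose y hy using hy
  -- The limit of `z n - z m` as `m → ∞` exists coordinatewise, and is small for large `n`.
  have hsub : ∀ ε > 0, ∃ N, ∀ n ≥ N,
      ∃ h : ((toKalton (z n)).1.1 - x, (toKalton (z n)).1.2 - y) ∈ kaltonSpace α,
        kaltonQuasiNorm α ⟨_, h⟩ ≤ (2 + 2 * kaltonLip α) * ε := fun ε hε => by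
    obtain ⟨N, hN⟩ := hcauchy ε hε
    refine ⟨N, fun n hn => ?_⟩
    refine kaltonSpace.mem_of_tendsto (z := fun m => toKalton (z n) - toKalton (z (m + N)))
      (fun m => hN n hn (m + N) (Nat.le_add_left N m)) (fun k => ?_) fun k => ?_
    · exact tendsto_const_nhds.sub ((Filter.tendsto_add_atTop_iff_nat N).2 (hx k))
    · exact tendsto_const_nhds.sub ((Filter.tendsto_add_atTop_iff_nat N).2 (hy k))
  obtain ⟨N₀, hN₀⟩ := hsub 1 one_pos
  obtain ⟨h₀, -⟩ := hN₀ N₀ le_rfl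
  have hmem : (x, y) ∈ kaltonSpace α := by
    have := (kaltonSpace α).sub_mem (toKalton (z N₀)).2 h₀
    convert this using 1
    refine Prod.ext ?_ ?_ <;> simp
  refine ⟨toKalton.symm ⟨(x, y), hmem⟩, Metric.tendsto_atTop.2 fun ε hε => ?_⟩
  obtain ⟨N, hN⟩ := hsub (ε / (2 * (2 + 2 * kaltonLip α))) (by positivity)
  refine ⟨N, fun n hn => ?_⟩
  obtain ⟨h, hle⟩ := hN n hn
  rw [dist_eq_norm]
  refine (norm_le _).trans_lt ?_
  rw [map_sub, LinearEquiv.apply_symm_apply]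
  refine lt_of_le_of_lt hle ?_
  have : (2 + 2 * kaltonLip α) * (ε / (2 * (2 + 2 * kaltonLip α))) = ε / 2 := by field_simp
  linarith

end KaltonBanach

/-! ### Phases of `t ^ (1 + iα)` at different scales -/

theorem norm_cpow_mul_I_add_sub_le (α : ℝ) {m s : ℝ} (hm : 0 < m) (hs : 0 ≤ s) :
    ‖((m + s : ℝ) : ℂ) ^ (α * I) - (m : ℂ) ^ (α * I)‖ ≤ |α| * (s / m) := by
  rcases eq_or_ne α 0 with rfl | hα
  · simp
  have hr : (α * I : ℂ) ≠ 0 := mul_ne_zero (Complex.ofReal_ne_zero.2 hα) Complex.I_ne_zero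
  have := (convex_Ici m).norm_image_sub_le_of_norm_hasDerivWithin_le (C := |α| / m)
    (f := fun x : ℝ => (x : ℂ) ^ (α * I)) (x := m) (y := m + s)
    (fun x hx => (hasDerivAt_ofReal_cpow_const (hm.trans_le hx).ne' hr).hasDerivWithinAt)
    (fun x hx => ?_) (Set.mem_Ici.2 le_rfl) (Set.mem_Ici.2 (by linarith))
  · refine this.trans_eq ?_
    rw [add_sub_cancel_left, Real.norm_of_nonneg hs]
    ring
  · have hx0 : 0 < x := hm.trans_le hx
    rw [norm_mul, Complex.norm_cpow_eq_rpow_re_of_pos hx0]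
    simp only [norm_mul, Complex.norm_real, Complex.norm_I, mul_one, Complex.sub_re,
      Complex.mul_re, Complex.ofReal_re, Complex.I_re, mul_zero, Complex.ofReal_im, Complex.I_im,
      sub_self, Complex.one_re, zero_sub, Real.norm_eq_abs, Real.rpow_neg_one]
    rw [div_eq_mul_inv]
    exact mul_le_mul_of_nonneg_left (inv_anti₀ hm hx) (abs_nonneg _)

/-- At large arguments `f_α` is almost affine. -/
theorem norm_kaltonFun_add_sub_le (α : ℝ) {m t : ℝ} (hm : 0 < m) (ht : 0 ≤ t) :
    ‖kaltonFun α (m + t) - kaltonFun α m - t * ((1 + α * I) * (m : ℂ) ^ (α * I))‖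
      ≤ kaltonLip α * |α| * (t ^ 2 / m) := by
  have hr : (1 + α * I : ℂ) ≠ 0 := fun h => by simpa using congrArg Complex.re h
  have hd : ∀ s ∈ Set.Icc 0 t, HasDerivWithinAt
      (fun s : ℝ => kaltonFun α (m + s) - s * ((1 + α * I) * (m : ℂ) ^ (α * I)))
      ((1 + α * I) * (((m + s : ℝ) : ℂ) ^ (α * I) - (m : ℂ) ^ (α * I))) (Set.Icc 0 t) s :=
    fun s hs => by
      have h1 := (hasDerivAt_ofReal_cpow_const (x := m + s) (by linarith [hs.1]) hr).comp_const_add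
        m s
      have h2 := (Complex.ofRealCLM.hasDerivAt (x := s)).mul_const
        ((1 + α * I) * (m : ℂ) ^ (α * I))
      refine (h1.sub h2).hasDerivWithinAt.congr_deriv ?_
      rw [add_sub_cancel_left, mul_sub]
      simp
  have := (convex_Icc 0 t).norm_image_sub_le_of_norm_hasDerivWithin_le
    (C := kaltonLip α * (|α| * (t / m))) hd (fun s hs => ?_) (Set.left_mem_Icc.2 ht)
    (Set.right_mem_Icc.2 ht)
  · simp only [add_zero, Complex.ofReal_zero, zero_mul, sub_zero, Real.norm_of_nonneg ht] at this
    rw [sub_right_comm]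
    refine this.trans_eq ?_
    ring
  · rw [norm_mul]
    refine mul_le_mul_of_nonneg_left ?_ (norm_nonneg _)
    refine (norm_cpow_mul_I_add_sub_le α hm hs.1).trans ?_
    have := hs.2
    gcongr

theorem sub_le_norm_kaltonFun_sub (α : ℝ) {m t : ℝ} (hm : 0 ≤ m) (ht : 0 ≤ t) :
    t ≤ ‖kaltonFun α (m + t) - kaltonFun α m‖ := by
  have := norm_sub_norm_le (kaltonFun α (m + t)) (kaltonFun α m)
  rw [norm_kaltonFun α (add_nonneg hm ht), norm_kaltonFun α hm] at this
  linarith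

theorem kaltonFun_one (α : ℝ) : kaltonFun α 1 = 1 := by simp [kaltonFun]

theorem exists_nat_kaltonFun_im_ne_zero (hα : α ≠ 0) :
    ∃ b : ℕ, 1 ≤ b ∧ (kaltonFun α b).im ≠ 0 := by
  have him : ∀ b : ℕ, 1 ≤ b → (kaltonFun α b).im = b * Real.sin (α * Real.log b) := fun b hb => by
    have hb0 : (b : ℂ) ≠ 0 := by
      have : b ≠ 0 := by omega
      exact_mod_cast this
    rw [kaltonFun, Complex.ofReal_natCast, Complex.cpow_add _ _ hb0, Complex.cpow_one,
      Complex.cpow_def_of_ne_zero hb0, ← Complex.natCast_log,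
      show ((Real.log b : ℝ) : ℂ) * (α * I) = ((α * Real.log b : ℝ) : ℂ) * I by push_cast; ring,
      ← Complex.ofReal_natCast, Complex.im_ofReal_mul, Complex.exp_ofReal_mul_I_im]
  by_contra! h
  have hsin : ∀ b : ℕ, 1 ≤ b → Real.sin (α * Real.log b) = 0 := fun b hb => by
    have := h b hb
    rw [him b hb, mul_eq_zero] at this
    rcases this with h0 | h0
    · have : b = 0 := by exact_mod_cast h0
      omega
    · exact h0
  -- For large `n` the numbers `α log n` and `α log (n + 1)` differ by less than `π`.
  obtain ⟨n, hn⟩ := exists_nat_gt |α|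
  have hn0 : (0 : ℝ) < n := (abs_nonneg α).trans_lt hn
  have hn1 : 1 ≤ n := by exact_mod_cast hn0
  set d := Real.log (n + 1 : ℕ) - Real.log n with hd
  have hd0 : 0 < d := sub_pos.2 (Real.log_lt_log hn0 (by push_cast; linarith))
  have hdn : d ≤ 1 / n := by
    rw [hd, ← Real.log_div (by positivity) hn0.ne']
    refine (Real.log_le_sub_one_of_pos (by positivity)).trans_eq ?_
    push_cast
    field_simp
    ring
  have hs : Real.sin (α * d) = 0 := by
    rw [hd, mul_sub, Real.sin_sub, hsin _ hn1, hsin _ (Nat.le_add_left 1 n)]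
    simp
  have hlt : |α * d| < Real.pi := by
    rw [abs_mul, abs_of_pos hd0]
    calc |α| * d ≤ |α| * (1 / n) := by gcongr
      _ < 1 := by
        rw [mul_one_div, div_lt_one hn0]
        exact hn
      _ < Real.pi := by linarith [Real.pi_gt_three]
  rw [abs_lt] at hlt
  exact mul_ne_zero hα hd0.ne' ((Real.sin_eq_zero_iff_of_lt_of_lt hlt.1 hlt.2).1 hs)

/-- The phases of `f_{-α}` and of the increments of `f_α` cannot be matched at all scales. If the
base point `m` is large, the increments are almost linear, whereas `f_{-α}` turns between `1` and
`b`. If `m` is bounded, the increments are close to the values of `f_α`, which turns in the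
direction opposite to that of `f_{-α}` between `B` and `b * B`. -/
theorem exists_scales_norm_le (hα : α ≠ 0) : ∃ (T : Finset ℕ) (D : ℝ), 0 < D ∧
    ∀ (m : ℝ) (x r : ℂ) (ε : ℝ), 0 ≤ m →
      (∀ j ∈ T, ‖(starRingEnd ℂ) (kaltonFun α j) * r
        - x * (kaltonFun α (m + j) - kaltonFun α m)‖ ≤ ε) → ‖r‖ ≤ D * ε := by
  obtain ⟨b, hb1, hb⟩ := exists_nat_kaltonFun_im_ne_zero hα
  have hκ := zero_lt_one.trans_le (one_le_kaltonLip α)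
  have hα' := abs_pos.2 hα
  have hb0 : (1 : ℝ) ≤ b := by exact_mod_cast hb1
  have hnb : ‖kaltonFun α b‖ = b := norm_kaltonFun α (by positivity)
  set c := kaltonFun α b with hc
  set δ₁ := ‖(starRingEnd ℂ) c - b‖ with hδ₁
  set δ₂ := ‖(starRingEnd ℂ) c - c‖ with hδ₂
  have hδ₁0 : 0 < δ₁ := norm_pos_iff.2 fun h => hb (by simpa using congrArg Complex.im h)
  have hδ₂0 : 0 < δ₂ := norm_pos_iff.2 fun h => hb (by
    have := congrArg Complex.im h
    simp only [Complex.sub_im, Complex.conj_im, Complex.zero_im] at this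
    linarith)
  obtain ⟨M, hM⟩ := exists_nat_gt (2 * (kaltonLip α * |α| * (b ^ 2 + b)) / δ₁)
  have hM0 : (0 : ℝ) < M := lt_of_le_of_lt (by positivity) hM
  obtain ⟨B, hB⟩ := exists_nat_gt (2 * (2 * kaltonLip α * M * (1 + b)) / δ₂)
  have hB0 : (0 : ℝ) < B := lt_of_le_of_lt (by positivity) hB
  refine ⟨{1, b, B, b * B}, 2 * (1 + b) / δ₁ + 2 * (1 + b) / (B * δ₂) + 1,
    by positivity, fun m x r ε hm hε => ?_⟩
  have h1 := hε 1 (by simp)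
  have h2 := hε b (by simp)
  have h3 := hε B (by simp)
  have h4 := hε (b * B) (by simp)
  have hε0 : 0 ≤ ε := (norm_nonneg _).trans h1
  rw [Nat.cast_one, kaltonFun_one, map_one, one_mul] at h1
  have hx : ‖x‖ ≤ ‖r‖ + ε := by
    have h5 := sub_le_norm_kaltonFun_sub α hm zero_le_one
    have h6 : ‖x * (kaltonFun α (m + 1) - kaltonFun α m)‖ ≤ ‖r‖ + ε := by
      calc _ = ‖r - (r - x * (kaltonFun α (m + 1) - kaltonFun α m))‖ := by rw [sub_sub_cancel]
        _ ≤ _ := (norm_sub_le _ _).trans (by linarith)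
    rw [norm_mul] at h6
    nlinarith [norm_nonneg x]
  rcases le_or_gt (M : ℝ) m with hMm | hMm
  · have hm0 : 0 < m := hM0.trans_le hMm
    have e : ((starRingEnd ℂ) c - b) * r
        = ((starRingEnd ℂ) c * r - x * (kaltonFun α (m + b) - kaltonFun α m))
          - b * (r - x * (kaltonFun α (m + 1) - kaltonFun α m))
          + x * ((kaltonFun α (m + b) - kaltonFun α m
              - (b : ℝ) * ((1 + α * I) * (m : ℂ) ^ (α * I)))
            - b * (kaltonFun α (m + 1) - kaltonFun α m
              - (1 : ℝ) * ((1 + α * I) * (m : ℂ) ^ (α * I)))) := by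
      push_cast
      ring
    have a1 := norm_kaltonFun_add_sub_le α hm0 (t := b) (by positivity)
    have a2 := norm_kaltonFun_add_sub_le α hm0 (t := 1) zero_le_one
    have hsmall : kaltonLip α * |α| * (b ^ 2 + b) / m ≤ δ₁ / 2 := by
      rw [div_lt_iff₀ hδ₁0] at hM
      rw [div_le_div_iff₀ hm0 two_pos]
      nlinarith
    have hn : δ₁ * ‖r‖ ≤ ε + b * ε + ‖x‖ * (δ₁ / 2) := by
      rw [hδ₁, ← norm_mul, e]
      refine (norm_add_le _ _).trans (add_le_add ((norm_sub_le _ _).trans (add_le_add h2 ?_)) ?_)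
      · rw [norm_mul, Complex.norm_natCast]
        exact mul_le_mul_of_nonneg_left h1 (by positivity)
      · rw [norm_mul]
        refine mul_le_mul_of_nonneg_left ?_ (norm_nonneg _)
        refine (norm_sub_le _ _).trans ?_
        rw [norm_mul, Complex.norm_natCast]
        refine (add_le_add a1 (mul_le_mul_of_nonneg_left a2 (Nat.cast_nonneg b))).trans ?_
        refine le_trans (le_of_eq ?_) hsmall
        ring
    have hr : ‖r‖ ≤ (2 * (1 + b) / δ₁ + 1) * ε := by
      have : δ₁ * ‖r‖ ≤ δ₁ * ((2 * (1 + b) / δ₁ + 1) * ε) := by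
        have e2 : δ₁ * ((2 * (1 + b) / δ₁ + 1) * ε) = 2 * (1 + b) * ε + δ₁ * ε := by field_simp
        rw [e2]
        nlinarith
      exact le_of_mul_le_mul_left this hδ₁0
    refine hr.trans (mul_le_mul_of_nonneg_right ?_ hε0)
    have : 0 ≤ 2 * (1 + b) / (B * δ₂) := by positivity
    linarith
  · have hshift : ∀ j : ℕ, ‖kaltonFun α (m + j) - kaltonFun α m - kaltonFun α j‖
        ≤ 2 * kaltonLip α * M := fun j => by
      have h5 := kaltonFun_lipschitz α (add_nonneg hm (Nat.cast_nonneg j)) (Nat.cast_nonneg j)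
      rw [add_sub_cancel_right, abs_of_nonneg hm] at h5
      rw [sub_right_comm]
      refine (norm_sub_le _ _).trans ?_
      rw [norm_kaltonFun α hm]
      have h6 : m ≤ kaltonLip α * m := le_mul_of_one_le_left hm (one_le_kaltonLip α)
      have h7 : kaltonLip α * m ≤ kaltonLip α * M := by gcongr
      have h8 : ‖(1 + α * I : ℂ)‖ = kaltonLip α := rfl
      rw [h8] at h5
      linarith
    have hcB : kaltonFun α ((b * B : ℕ) : ℝ) = c * kaltonFun α B := by
      rw [Nat.cast_mul, kaltonFun_mul α (by positivity) (by positivity)]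
    have hnB : ‖kaltonFun α B‖ = B := norm_kaltonFun α hB0.le
    have e : (starRingEnd ℂ) (kaltonFun α B) * ((starRingEnd ℂ) c - c) * r
        = ((starRingEnd ℂ) (kaltonFun α ((b * B : ℕ) : ℝ)) * r
            - x * (kaltonFun α (m + (b * B : ℕ)) - kaltonFun α m))
          - c * ((starRingEnd ℂ) (kaltonFun α B) * r
            - x * (kaltonFun α (m + B) - kaltonFun α m))
          + x * ((kaltonFun α (m + (b * B : ℕ)) - kaltonFun α m - kaltonFun α ((b * B : ℕ) : ℝ))
            - c * (kaltonFun α (m + B) - kaltonFun α m - kaltonFun α B)) := by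
      rw [hcB, map_mul]
      ring
    have hn : B * δ₂ * ‖r‖ ≤ ε + b * ε + ‖x‖ * (2 * kaltonLip α * M * (1 + b)) := by
      rw [hδ₂, ← hnB, ← Complex.norm_conj (kaltonFun α B), ← norm_mul, ← norm_mul, e]
      refine (norm_add_le _ _).trans (add_le_add ((norm_sub_le _ _).trans (add_le_add h4 ?_)) ?_)
      · rw [norm_mul, hnb]
        exact mul_le_mul_of_nonneg_left h3 (by positivity)
      · rw [norm_mul]
        refine mul_le_mul_of_nonneg_left ?_ (norm_nonneg _)
        refine (norm_sub_le _ _).trans ?_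
        rw [norm_mul, hnb]
        refine (add_le_add (hshift _) (mul_le_mul_of_nonneg_left (hshift B)
          (Nat.cast_nonneg b))).trans_eq ?_
        ring
    have hlarge : 2 * kaltonLip α * M * (1 + b) ≤ B * δ₂ / 2 := by
      rw [div_lt_iff₀ hδ₂0] at hB
      linarith
    have hr : ‖r‖ ≤ (2 * (1 + b) / (B * δ₂) + 1) * ε := by
      have hBδ : 0 < B * δ₂ := mul_pos hB0 hδ₂0
      have : B * δ₂ * ‖r‖ ≤ B * δ₂ * ((2 * (1 + b) / (B * δ₂) + 1) * ε) := by
        have e2 : B * δ₂ * ((2 * (1 + b) / (B * δ₂) + 1) * ε)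
            = 2 * (1 + b) * ε + B * δ₂ * ε := by field_simp
        have h9 : ‖x‖ * (2 * kaltonLip α * M * (1 + b)) ≤ (‖r‖ + ε) * (B * δ₂ / 2) := by
          gcongr
        rw [e2]
        linarith
      exact le_of_mul_le_mul_left this hBδ
    refine hr.trans (mul_le_mul_of_nonneg_right ?_ hε0)
    have : 0 ≤ 2 * (1 + b) / δ₁ := by positivity
    linarith

/-- The rescaled form of `exists_scales_norm_le`. -/
theorem exists_scales_mul_norm_le (hα : α ≠ 0) : ∃ (T : Finset ℕ) (D : ℝ), 0 < D ∧
    ∀ (Λ m : ℝ) (x r : ℂ), 0 < Λ → 0 ≤ m →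
      Λ * ‖r‖ ≤ D * ∑ j ∈ T, ‖(starRingEnd ℂ) (kaltonFun α (Λ * j)) * r
        - x * (kaltonFun α (m + Λ * j) - kaltonFun α m)‖ := by
  obtain ⟨T, D, hD, h⟩ := exists_scales_norm_le hα
  refine ⟨T, D, hD, fun Λ m x r hΛ hm => ?_⟩
  have := h (m / Λ) (kaltonFun α Λ * x) ((starRingEnd ℂ) (kaltonFun α Λ) * r)
    (∑ j ∈ T, ‖(starRingEnd ℂ) (kaltonFun α (Λ * j)) * r
        - x * (kaltonFun α (m + Λ * j) - kaltonFun α m)‖) (by positivity) fun j hj => ?_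
  · rwa [norm_mul, Complex.norm_conj, norm_kaltonFun α hΛ.le] at this
  · refine le_trans (le_of_eq ?_) (Finset.single_le_sum
      (f := fun j : ℕ => ‖(starRingEnd ℂ) (kaltonFun α (Λ * j)) * r
        - x * (kaltonFun α (m + Λ * j) - kaltonFun α m)‖) (fun _ _ => norm_nonneg _) hj)
    have e1 : kaltonFun α (m + Λ * j) = kaltonFun α Λ * kaltonFun α (m / Λ + j) := by
      rw [← kaltonFun_mul α hΛ.le (by positivity)]
      congr 1
      field_simp
    have e2 : kaltonFun α m = kaltonFun α Λ * kaltonFun α (m / Λ) := by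
      rw [← kaltonFun_mul α hΛ.le (by positivity)]
      congr 1
      field_simp
    have e3 : kaltonFun α (Λ * j) = kaltonFun α Λ * kaltonFun α j :=
      kaltonFun_mul α hΛ.le (by positivity)
    simp only [e1, e2, e3, map_mul]
    congr 1
    ring

/-! ### Disjoint blocks -/

/-- The indicator function of the `k`-th block `{j | c j = k}` of a colouring `c` of `ℕ`. -/
def blockMask (c : ℕ → ℕ) (k : ℕ) : ℕ → ℂ := fun j => if c j = k then 1 else 0

theorem norm_blockMask_le (c : ℕ → ℕ) (k j : ℕ) : ‖blockMask c k j‖ ≤ 1 := by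
  rw [blockMask]
  split_ifs <;> simp

theorem mulSeq_blockMask_apply (c : ℕ → ℕ) (k : ℕ) (x : ℕ → ℂ) (j : ℕ) :
    mulSeq (blockMask c k) x j = if c j = k then x j else 0 := by
  simp [blockMask]

theorem sum_mulSeq_blockMask_apply (c : ℕ → ℕ) (F : Finset ℕ) (x : ℕ → ℕ → ℂ) (j : ℕ) :
    (∑ k ∈ F, mulSeq (blockMask c k) (x k)) j = if c j ∈ F then x (c j) j else 0 := by
  simp only [Finset.sum_apply, mulSeq_blockMask_apply]
  exact Finset.sum_ite_eq F (c j) fun k => x k j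

theorem HasL2Bound.sum_blockMask (c : ℕ → ℕ) (F : Finset ℕ) {x : ℕ → ℕ → ℂ} {C : ℝ} (hC : 0 ≤ C)
    (h : ∀ k ∈ F, HasL2Bound (x k) C) :
    HasL2Bound (∑ k ∈ F, mulSeq (blockMask c k) (x k)) (C * √F.card) := by
  refine HasL2Bound.of_sum_sq_le (by positivity) fun s => ?_
  have e : ∀ j, ‖(∑ k ∈ F, mulSeq (blockMask c k) (x k)) j‖ ^ 2
      = ∑ k ∈ F, if c j = k then ‖x k j‖ ^ 2 else 0 := fun j => by
    rw [sum_mulSeq_blockMask_apply, Finset.sum_ite_eq F (c j) fun k => ‖x k j‖ ^ 2]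
    split_ifs <;> simp
  simp only [e]
  rw [Finset.sum_comm, mul_pow, Real.sq_sqrt (Nat.cast_nonneg _), mul_comm, ← nsmul_eq_mul]
  refine Finset.sum_le_card_nsmul _ _ _ fun k hk => le_trans (Finset.sum_le_sum fun j _ => ?_)
    ((h k hk).sum_sq_le s)
  split_ifs
  · exact le_rfl
  · positivity

theorem HasL2Bound.mulSeq_blockMask (c : ℕ → ℕ) (k : ℕ) {x : ℕ → ℂ} {C : ℝ}
    (h : HasL2Bound x C) : HasL2Bound (mulSeq (blockMask c k) x) C :=
  h.of_norm_le fun j => by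
    rw [mulSeq_apply, norm_mul]
    exact mul_le_of_le_one_left (norm_nonneg _) (norm_blockMask_le c k j)

theorem sum_l2Norm_sq_mulSeq_blockMask_le (c : ℕ → ℕ) (F : Finset ℕ) {x : ℕ → ℂ}
    (hx : Memℓp x 2) :
    ∑ k ∈ F, l2Norm (mulSeq (blockMask c k) x) ^ 2 ≤ l2Norm x ^ 2 := by
  have hs : ∀ k ∈ F, Summable fun j => ‖mulSeq (blockMask c k) x j‖ ^ 2 := fun k _ =>
    (memLp_two_iff _).1 (hx.hasL2Bound.mulSeq_blockMask c k).mem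
  simp only [l2Norm_sq]
  rw [← Summable.tsum_finsetSum hs]
  refine (summable_sum hs).tsum_le_tsum (fun j => ?_) ((memLp_two_iff x).1 hx)
  have e : ∀ k ∈ F, ‖mulSeq (blockMask c k) x j‖ ^ 2 = if c j = k then ‖x j‖ ^ 2 else 0 :=
    fun k _ => by
      rw [mulSeq_blockMask_apply]
      split_ifs <;> simp
  rw [Finset.sum_congr rfl e, Finset.sum_ite_eq F (c j) fun _ => ‖x j‖ ^ 2]
  split_ifs
  · exact le_rfl
  · positivity

/-- If the sum over `n` blocks has norm at most `D √n`, some block has norm at most `D`. -/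
theorem exists_hasL2Bound_block (c : ℕ → ℕ) {F : Finset ℕ} (hF : F.Nonempty) {x : ℕ → ℕ → ℂ}
    {D : ℝ} (hD : 0 ≤ D)
    (h : HasL2Bound (∑ k ∈ F, mulSeq (blockMask c k) (x k)) (D * √F.card)) :
    ∃ k ∈ F, HasL2Bound (mulSeq (blockMask c k) (x k)) D := by
  have e : ∀ k ∈ F, mulSeq (blockMask c k) (∑ i ∈ F, mulSeq (blockMask c i) (x i))
      = mulSeq (blockMask c k) (x k) := fun k hk => by
    funext j
    rw [mulSeq_blockMask_apply, mulSeq_blockMask_apply, sum_mulSeq_blockMask_apply]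
    split_ifs with h1 h2
    · rw [h1]
    · exact absurd (h1 ▸ hk) h2
    · rfl
  by_contra! hcon
  have hlt : ∀ k ∈ F, D < l2Norm (mulSeq (blockMask c k) (x k)) := fun k hk => by
    by_contra! hle
    refine hcon k hk ⟨?_, hle⟩
    rw [← e k hk]
    exact (h.mulSeq_blockMask c k).mem
  have h1 := sum_l2Norm_sq_mulSeq_blockMask_le c F h.mem
  have h2 := pow_le_pow_left₀ (l2Norm_nonneg _) h.le 2
  rw [mul_pow, Real.sq_sqrt (Nat.cast_nonneg _)] at h2
  have h3 : ∑ _k ∈ F, D ^ 2 < ∑ k ∈ F,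
      l2Norm (mulSeq (blockMask c k) (∑ i ∈ F, mulSeq (blockMask c i) (x i))) ^ 2 :=
    Finset.sum_lt_sum_of_nonempty hF fun k hk => by
      rw [e k hk]
      exact pow_lt_pow_left₀ (hlt k hk) hD two_ne_zero
  rw [Finset.sum_const, nsmul_eq_mul] at h3
  linarith

/-- The gliding hump: from vectors whose coordinates tend to zero one can select infinitely many
that have a large part in pairwise disjoint blocks. -/
theorem exists_blocks {r : ℕ → ℕ → ℂ} (hr : ∀ k, Memℓp (r k) 2)
    (h0 : ∀ j, Filter.Tendsto (fun k => r k j) Filter.atTop (nhds 0)) {K : Set ℕ}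
    (hK : K.Infinite) {δ : ℝ} (hδ : 0 < δ) (hKδ : ∀ k ∈ K, δ < l2Norm (r k)) :
    ∃ K' ⊆ K, K'.Infinite ∧
      ∃ c : ℕ → ℕ, ∀ k ∈ K', δ / 2 ≤ l2Norm (mulSeq (blockMask c k) (r k)) := by
  have step : ∀ a : ℕ, ∃ k b : ℕ, k ∈ K ∧ a ≤ k ∧ k < b ∧
      (δ / 2) ^ 2 ≤ ∑ j ∈ Finset.Ico a b, ‖r k j‖ ^ 2 := fun a => by
    have h1 : Filter.Tendsto (fun k => ∑ j ∈ Finset.range a, ‖r k j‖ ^ 2) Filter.atTop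
        (nhds 0) := by
      simpa using tendsto_finsetSum (Finset.range a) fun j _ => (h0 j).norm.pow 2
    have h2 := h1.eventually_lt_const (show (0 : ℝ) < (δ / 2) ^ 2 by positivity)
    obtain ⟨k, hkK, hk, hak⟩ := ((Nat.frequently_atTop_iff_infinite.2 hK).and_eventually
      (h2.and (Filter.eventually_ge_atTop a))).exists
    have h3 := ((memLp_two_iff _).1 (hr k)).hasSum.tendsto_sum_nat
    rw [← l2Norm_sq] at h3
    have h4 := h3.eventually_const_lt (pow_lt_pow_left₀ (hKδ k hkK) hδ.le two_ne_zero)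
    obtain ⟨b, hb, hkb⟩ := (h4.and (Filter.eventually_gt_atTop k)).exists
    refine ⟨k, b, hkK, hak, hkb, ?_⟩
    have h5 := Finset.sum_range_add_sum_Ico (fun j => ‖r k j‖ ^ 2) (hak.trans hkb.le)
    nlinarith
  choose k b hkK hak hkb hsum using step
  let a : ℕ → ℕ := fun i => b^[i] 0
  have ha : ∀ i, a (i + 1) = b (a i) := fun i => Function.iterate_succ_apply' b i 0
  have hamono : StrictMono a := strictMono_nat_of_lt_succ fun i => by
    rw [ha]
    exact (hak _).trans_lt (hkb _)
  have hkmono : StrictMono fun i => k (a i) := strictMono_nat_of_lt_succ fun i => by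
    have := hkb (a i)
    rw [← ha] at this
    exact this.trans_le (hak _)
  refine ⟨Set.range fun i => k (a i), ?_, Set.infinite_range_of_injective hkmono.injective,
    fun j => k (a (Nat.findGreatest (fun i => a i ≤ j) j)), ?_⟩
  · rintro _ ⟨i, rfl⟩
    exact hkK _
  · rintro _ ⟨i, rfl⟩
    have hc : ∀ j ∈ Finset.Ico (a i) (b (a i)), Nat.findGreatest (fun i => a i ≤ j) j = i :=
      fun j hj => by
        obtain ⟨hj1, hj2⟩ := Finset.mem_Ico.1 hj
        have h1 : a (Nat.findGreatest (fun i => a i ≤ j) j) ≤ j :=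
          Nat.findGreatest_spec (P := fun i => a i ≤ j) (Nat.zero_le j) (Nat.zero_le j)
        refine le_antisymm ?_ (Nat.le_findGreatest ((hamono.id_le i).trans hj1) hj1)
        by_contra! hlt
        have h2 := hamono.monotone (Nat.succ_le_of_lt hlt)
        rw [Nat.succ_eq_add_one, ha] at h2
        omega
    refine le_of_pow_le_pow_left₀ two_ne_zero (l2Norm_nonneg _) ((hsum (a i)).trans ?_)
    refine le_trans (le_of_eq (Finset.sum_congr rfl fun j hj => ?_))
      (sum_norm_sq_le ((hr _).hasL2Bound.mulSeq_blockMask _ _).mem (Finset.Ico (a i) (b (a i))))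
    rw [mulSeq_blockMask_apply, hc j hj, if_pos rfl]

/-! ### Diagonal blocks of operators -/

theorem sum_pow_mul_inv_pow {ζ : ℂ} {N : ℕ} (hζ : IsPrimitiveRoot ζ N) {k l : ℕ} (hk : k < N)
    (hl : l < N) :
    ∑ g ∈ Finset.range N, (ζ ^ (g * l))⁻¹ * ζ ^ (g * k) = if l = k then (N : ℂ) else 0 := by
  have hζ0 : ζ ≠ 0 := hζ.ne_zero (by omega)
  have e : ∀ g, (ζ ^ (g * l))⁻¹ * ζ ^ (g * k) = ((ζ ^ l)⁻¹ * ζ ^ k) ^ g := fun g => by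
    rw [mul_pow, inv_pow, ← pow_mul, ← pow_mul, mul_comm l, mul_comm k]
  simp only [e]
  split_ifs with h
  · rw [h, inv_mul_cancel₀ (pow_ne_zero _ hζ0)]
    simp
  · have h1 : (ζ ^ l)⁻¹ * ζ ^ k ≠ 1 := fun h1 => h (hζ.pow_inj hl hk (by
      rwa [inv_mul_eq_one₀ (pow_ne_zero _ hζ0)] at h1))
    rw [geom_sum_eq h1, mul_pow, inv_pow, ← pow_mul, ← pow_mul, mul_comm l, mul_comm k, pow_mul,
      pow_mul, hζ.pow_eq_one]
    simp

namespace kaltonSpace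

/-- The restriction of the elements of `Z_α` to the `k`-th block of a colouring. -/
noncomputable def blockProj (α : ℝ) (c : ℕ → ℕ) (k : ℕ) : kaltonSpace α →ₗ[ℂ] kaltonSpace α :=
  (isKaltonBounded_mulSeq α (norm_blockMask_le c k)).lift

@[simp] theorem blockProj_fst (c : ℕ → ℕ) (k : ℕ) (z : kaltonSpace α) :
    (blockProj α c k z).1.1 = mulSeq (blockMask c k) z.1.1 := rfl

@[simp] theorem blockProj_snd (c : ℕ → ℕ) (k : ℕ) (z : kaltonSpace α) :
    (blockProj α c k z).1.2 = mulSeq (blockMask c k) z.1.2 := rfl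

theorem coe_sum_fst {ι : Type*} (s : Finset ι) (z : ι → kaltonSpace α) :
    (∑ i ∈ s, z i).1.1 = ∑ i ∈ s, (z i).1.1 := by
  simp [Prod.fst_sum]

theorem coe_sum_snd {ι : Type*} (s : Finset ι) (z : ι → kaltonSpace α) :
    (∑ i ∈ s, z i).1.2 = ∑ i ∈ s, (z i).1.2 := by
  simp [Prod.snd_sum]

/-- A bound for multiplication by sequences in the unit ball of `ℓ_∞` as operators on `Z_α`. -/
noncomputable def maskConst (α : ℝ) : ℝ := 1 + 2 * kaltonLip α

theorem one_le_maskConst (α : ℝ) : 1 ≤ maskConst α := by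
  have := kaltonLip_nonneg α
  rw [maskConst]
  linarith

theorem quasiNorm_lift_mulSeq_le {μ : ℕ → ℂ} (hμ : ∀ k, ‖μ k‖ ≤ 1) (z : kaltonSpace α) :
    kaltonQuasiNorm α ((isKaltonBounded_mulSeq α hμ).lift z)
      ≤ maskConst α * kaltonQuasiNorm α z :=
  (isKaltonBounded_mulSeq α hμ).quasiNorm_lift_le
    (mul_nonneg zero_le_two (kaltonLip_nonneg α)) z

/-- The diagonal blocks of a family are controlled by its unimodular combinations. The average of
`μ⁻¹ • ∑ θ k • w k`, where `θ` runs through the powers of a root of unity and the multiplier `μ`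
equals `θ k` on the `k`-th block, annihilates everything off the diagonal. -/
theorem quasiNorm_sum_blockProj_le (c : ℕ → ℕ) (F : Finset ℕ) (w : ℕ → kaltonSpace α) {C : ℝ}
    (h : ∀ θ : ℕ → ℂ, (∀ k, ‖θ k‖ = 1) → kaltonQuasiNorm α (∑ k ∈ F, θ k • w k) ≤ C) :
    kaltonQuasiNorm α (∑ k ∈ F, blockProj α c k (w k))
      ≤ triangleConst α * maskConst α * C := by
  obtain ⟨M, hM⟩ : ∃ M, ∀ k ∈ F, k < M :=
    ⟨F.sup id + 1, fun k hk => Nat.lt_succ_of_le (Finset.le_sup (f := id) hk)⟩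
  -- Positions outside the blocks of `F` get a frequency `M` of their own.
  let c' : ℕ → ℕ := fun j => if c j ∈ F then c j else M
  have hc' : ∀ j, c' j < M + 1 := fun j => by
    simp only [c']
    split_ifs with hj
    · exact (hM _ hj).trans (Nat.lt_succ_self M)
    · exact Nat.lt_succ_self M
  have hc'k : ∀ k ∈ F, ∀ j, c' j = k ↔ c j = k := fun k hk j => by
    simp only [c']
    split_ifs with hj
    · exact Iff.rfl
    · exact ⟨fun e => absurd (hM k hk) (by omega), fun e => absurd (e ▸ hk) hj⟩
  have hζ := Complex.isPrimitiveRoot_exp (M + 1) (Nat.succ_ne_zero M)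
  set ζ := Complex.exp (2 * Real.pi * I / (M + 1 : ℕ)) with hζdef
  have hζ1 : ‖ζ‖ = 1 := hζ.norm'_eq_one (Nat.succ_ne_zero M)
  have hμ : ∀ g j : ℕ, ‖(ζ ^ (g * c' j))⁻¹‖ ≤ 1 := fun g j => by simp [hζ1]
  have hseq : ∀ x : ℕ → ℕ → ℂ, ∑ g ∈ Finset.range (M + 1),
      mulSeq (fun j => (ζ ^ (g * c' j))⁻¹) (∑ k ∈ F, ζ ^ (g * k) • x k)
        = ((M + 1 : ℕ) : ℂ) • ∑ k ∈ F, mulSeq (blockMask c k) (x k) := fun x => by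
    funext j
    simp only [Finset.sum_apply, mulSeq_apply, Pi.smul_apply, smul_eq_mul, Finset.mul_sum]
    rw [Finset.sum_comm]
    refine Finset.sum_congr rfl fun k hk => ?_
    simp only [← mul_assoc]
    rw [← Finset.sum_mul, sum_pow_mul_inv_pow hζ ((hM k hk).trans (Nat.lt_succ_self M)) (hc' j),
      blockMask]
    simp only [hc'k k hk j]
    split_ifs <;> simp
  have havg : ∑ g ∈ Finset.range (M + 1), (isKaltonBounded_mulSeq α (hμ g)).lift
      (∑ k ∈ F, ζ ^ (g * k) • w k) = ((M + 1 : ℕ) : ℂ) • ∑ k ∈ F, blockProj α c k (w k) := by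
    refine Subtype.ext (Prod.ext ?_ ?_)
    · have := hseq fun k => (w k).1.1
      rw [coe_sum_fst]
      simp only [IsKaltonBounded.lift_fst, coe_sum_fst, Submodule.coe_smul, Prod.smul_fst,
        blockProj_fst]
      exact this
    · have := hseq fun k => (w k).1.2
      rw [coe_sum_snd]
      simp only [IsKaltonBounded.lift_snd, coe_sum_snd, Submodule.coe_smul, Prod.smul_snd,
        blockProj_snd]
      exact this
  have hle := quasiNorm_sum_le (Finset.range (M + 1)) fun g =>
    (isKaltonBounded_mulSeq α (hμ g)).lift (∑ k ∈ F, ζ ^ (g * k) • w k)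
  rw [havg, quasiNorm_smul, Complex.norm_natCast] at hle
  have hsum : ∑ g ∈ Finset.range (M + 1), kaltonQuasiNorm α
      ((isKaltonBounded_mulSeq α (hμ g)).lift (∑ k ∈ F, ζ ^ (g * k) • w k))
        ≤ ∑ g ∈ Finset.range (M + 1), maskConst α * C :=
    Finset.sum_le_sum fun g _ => (quasiNorm_lift_mulSeq_le (hμ g) _).trans
      (mul_le_mul_of_nonneg_left (h (fun k => ζ ^ (g * k)) fun k => by simp [hζ1])
        (zero_le_one.trans (one_le_maskConst α)))
  rw [Finset.sum_const, Finset.card_range, nsmul_eq_mul] at hsum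
  have hK := zero_le_one.trans (one_le_triangleConst α)
  refine le_of_mul_le_mul_left (hle.trans ((mul_le_mul_of_nonneg_left hsum hK).trans_eq ?_))
    (show (0 : ℝ) < (M + 1 : ℕ) by positivity)
  ring

/-- Comparison of the normalizations in the quasi-norm of `n` disjoint vectors and of a single
one: the arguments of `f_α` differ by `log √n`. -/
theorem exists_block_hasL2Bound (c : ℕ → ℕ) {F : Finset ℕ} (hF : F.Nonempty)
    (p : ℕ → kaltonSpace α) (τ : ℕ → ℕ → ℂ) {C : ℝ} (hC : 0 < C)
    (hp : ∀ k ∈ F, kaltonQuasiNorm α (p k) ≤ C) (W : kaltonSpace α)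
    (hW : kaltonQuasiNorm α W ≤ C * √F.card)
    (hW1 : W.1.1 = ∑ k ∈ F, mulSeq (blockMask c k) (p k).1.1)
    (hW2 : W.1.2 = ∑ k ∈ F, mulSeq (blockMask c k) ((p k).1.2 + τ k)) :
    ∃ k ∈ F, HasL2Bound (mulSeq (blockMask c k) fun j => τ k j - (p k).1.1 j
      * (kaltonFun α (Real.log (C / ‖(p k).1.1 j‖) + Real.log √F.card)
        - kaltonFun α (Real.log (C / ‖(p k).1.1 j‖)))) (2 * (1 + kaltonLip α) * C) := by
  have hκ := kaltonLip_nonneg α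
  refine exists_hasL2Bound_block c hF (by positivity) ?_
  have h1 := hasL2Bound_snd_sub_scaledMap W hW
  have h2 := HasL2Bound.sum_blockMask c F (C := (1 + kaltonLip α) * C) (by positivity)
    fun k hk => hasL2Bound_snd_sub_scaledMap (p k) (hp k hk)
  have hn : 0 < √(F.card : ℝ) := Real.sqrt_pos.2 (by exact_mod_cast hF.card_pos)
  convert h1.sub h2 using 1
  · funext j
    rw [Pi.sub_apply, Pi.sub_apply, scaledMap, hW1, hW2]
    simp only [sum_mulSeq_blockMask_apply]
    split_ifs with hj
    · simp only [Pi.add_apply, Pi.sub_apply, scaledMap]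
      rcases eq_or_ne ((p (c j)).1.1 j) 0 with h0 | h0
      · simp [h0]
      · have h0' := norm_pos_iff.2 h0
        rw [← Real.log_mul (by positivity) hn.ne',
          show C / ‖(p (c j)).1.1 j‖ * √(F.card : ℝ) = C * √(F.card : ℝ) / ‖(p (c j)).1.1 j‖ by
            ring]
        ring
    · simp
  · ring

end kaltonSpace

/-! ### Flat vectors -/

theorem sum_smul_single_apply (F : Finset ℕ) (θ : ℕ → ℂ) (j : ℕ) :
    (∑ k ∈ F, θ k • (Pi.single k 1 : ℕ → ℂ)) j = if j ∈ F then θ j else 0 := by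
  simp [Finset.sum_apply, Pi.single_apply]

theorem hasL2Bound_sum_smul_single (F : Finset ℕ) {θ : ℕ → ℂ} (hθ : ∀ k, ‖θ k‖ = 1) :
    HasL2Bound (∑ k ∈ F, θ k • (Pi.single k 1 : ℕ → ℂ)) √F.card := by
  refine HasL2Bound.of_sum_sq_le (Real.sqrt_nonneg _) fun s => ?_
  rw [Real.sq_sqrt (Nat.cast_nonneg _)]
  have e : ∀ j, ‖(∑ k ∈ F, θ k • (Pi.single k 1 : ℕ → ℂ)) j‖ ^ 2 = if j ∈ F then 1 else 0 :=
    fun j => by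
      rw [sum_smul_single_apply]
      split_ifs <;> simp [hθ]
  simp only [e]
  rw [← Finset.sum_filter, Finset.sum_const, nsmul_eq_mul, mul_one]
  exact_mod_cast Finset.card_le_card fun j hj => (Finset.mem_filter.1 hj).2

theorem l2Norm_sum_smul_single (F : Finset ℕ) {θ : ℕ → ℂ} (hθ : ∀ k, ‖θ k‖ = 1) :
    l2Norm (∑ k ∈ F, θ k • (Pi.single k 1 : ℕ → ℂ)) = √F.card := by
  refine le_antisymm (hasL2Bound_sum_smul_single F hθ).le ?_
  refine Real.sqrt_le_iff.2 ⟨l2Norm_nonneg _, ?_⟩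
  refine le_trans (le_of_eq ?_) (sum_norm_sq_le (hasL2Bound_sum_smul_single F hθ).mem F)
  rw [Finset.sum_congr rfl fun j hj => by rw [sum_smul_single_apply, if_pos hj, hθ, one_pow]]
  simp

theorem kaltonMap_sum_smul_single (α : ℝ) (F : Finset ℕ) {θ : ℕ → ℂ} (hθ : ∀ k, ‖θ k‖ = 1) :
    kaltonMap α (∑ k ∈ F, θ k • (Pi.single k 1 : ℕ → ℂ))
      = kaltonFun α (Real.log √F.card) • ∑ k ∈ F, θ k • (Pi.single k 1 : ℕ → ℂ) := by
  funext j
  rw [kaltonMap_eq_scaledMap, scaledMap, l2Norm_sum_smul_single F hθ, Pi.smul_apply,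
    sum_smul_single_apply]
  split_ifs
  · rw [hθ, div_one, smul_eq_mul, mul_comm]
  · simp

theorem kaltonMap_zero (α : ℝ) : kaltonMap α 0 = 0 := by
  funext j
  simp [kaltonMap]

namespace kaltonSpace

/-- The vector `(x, Ω_α x)`. -/
noncomputable def graph (α : ℝ) {x : ℕ → ℂ} (hx : Memℓp x 2) : kaltonSpace α :=
  ⟨(x, kaltonMap α x), hx, by
    rw [sub_self]
    exact zero_memℓp⟩

theorem quasiNorm_graph {x : ℕ → ℂ} (hx : Memℓp x 2) :
    kaltonQuasiNorm α (graph α hx) = l2Norm x := by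
  simp [kaltonQuasiNorm, graph]

/-- The vector `(0, y)`. -/
noncomputable def inr (α : ℝ) {y : ℕ → ℂ} (hy : Memℓp y 2) : kaltonSpace α :=
  ⟨(0, y), zero_memℓp, by
    rw [kaltonMap_zero, sub_zero]
    exact hy⟩

theorem memℓp_single (k : ℕ) : Memℓp (Pi.single k 1 : ℕ → ℂ) 2 := by
  simpa using (hasL2Bound_sum_smul_single {k} (θ := 1) (by simp)).mem

/-- The vector `(e_k, 0)`, where `e_k` is the `k`-th unit sequence. -/
noncomputable def fstBasis (α : ℝ) (k : ℕ) : kaltonSpace α :=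
  ⟨(Pi.single k 1, 0), memℓp_single k, by
    have := kaltonMap_sum_smul_single α {k} (θ := 1) (by simp)
    simp only [Finset.sum_singleton, Pi.one_apply, one_smul, Finset.card_singleton, Nat.cast_one,
      Real.sqrt_one, Real.log_one, kaltonFun_zero, zero_smul] at this
    rw [this, sub_zero]
    exact zero_memℓp⟩

/-- The vector `(0, e_k)`, where `e_k` is the `k`-th unit sequence. -/
noncomputable def sndBasis (α : ℝ) (k : ℕ) : kaltonSpace α := inr α (memℓp_single k)

theorem quasiNorm_sum_sndBasis (F : Finset ℕ) {θ : ℕ → ℂ} (hθ : ∀ k, ‖θ k‖ = 1) :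
    kaltonQuasiNorm α (∑ k ∈ F, θ k • sndBasis α k) = √F.card := by
  have h1 : (∑ k ∈ F, θ k • sndBasis α k).1.1 = 0 := by
    rw [coe_sum_fst]
    exact Finset.sum_eq_zero fun k _ => smul_zero (θ k)
  have h2 : (∑ k ∈ F, θ k • sndBasis α k).1.2 = ∑ k ∈ F, θ k • (Pi.single k 1 : ℕ → ℂ) :=
    coe_sum_snd F _
  rw [kaltonQuasiNorm, h1, h2, kaltonMap_zero, sub_zero, l2Norm_zero, zero_add,
    l2Norm_sum_smul_single F hθ]

/-- The vectors `(x, Ω_α x)` for flat `x` supported by `n` coordinates. -/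
theorem quasiNorm_sum_flat (F : Finset ℕ) {θ : ℕ → ℂ} (hθ : ∀ k, ‖θ k‖ = 1) :
    kaltonQuasiNorm α (∑ k ∈ F, θ k • (fstBasis α k + kaltonFun α (Real.log √F.card)
      • sndBasis α k)) = √F.card := by
  set c := kaltonFun α (Real.log √F.card) with hc
  have h1 : (∑ k ∈ F, θ k • (fstBasis α k + c • sndBasis α k)).1.1
      = ∑ k ∈ F, θ k • (Pi.single k 1 : ℕ → ℂ) := by
    rw [coe_sum_fst]
    refine Finset.sum_congr rfl fun k _ => ?_
    change θ k • ((Pi.single k 1 : ℕ → ℂ) + c • (0 : ℕ → ℂ)) = _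
    rw [smul_zero, add_zero]
  have h2 : (∑ k ∈ F, θ k • (fstBasis α k + c • sndBasis α k)).1.2
      = c • ∑ k ∈ F, θ k • (Pi.single k 1 : ℕ → ℂ) := by
    rw [coe_sum_snd, Finset.smul_sum]
    refine Finset.sum_congr rfl fun k _ => ?_
    change θ k • ((0 : ℕ → ℂ) + c • (Pi.single k 1 : ℕ → ℂ)) = _
    rw [zero_add, smul_comm]
  rw [kaltonQuasiNorm, h1, h2, kaltonMap_sum_smul_single α F hθ, sub_self, l2Norm_zero, add_zero,
    l2Norm_sum_smul_single F hθ]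

end kaltonSpace

/-- A sequence whose unimodular combinations of length `n` are `O(√n)` tends to zero. -/
theorem tendsto_zero_of_norm_sum_le {φ : ℕ → ℂ} {C : ℝ}
    (h : ∀ (F : Finset ℕ) (θ : ℕ → ℂ), (∀ k, ‖θ k‖ = 1) → ‖∑ k ∈ F, θ k * φ k‖ ≤ C * √F.card) :
    Filter.Tendsto φ Filter.atTop (nhds 0) := by
  rw [← Nat.cofinite_eq_atTop, Metric.tendsto_nhds]
  intro ε hε
  rw [Filter.eventually_cofinite]
  by_contra hinf
  obtain ⟨n, hn⟩ := exists_nat_gt ((C / ε) ^ 2)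
  obtain ⟨F, hF, hFn⟩ := Set.Infinite.exists_subset_card_eq hinf n
  let θ : ℕ → ℂ := fun k => if φ k = 0 then 1 else (starRingEnd ℂ) (φ k) / ‖φ k‖
  have hθ : ∀ k, ‖θ k‖ = 1 := fun k => by
    simp only [θ]
    split_ifs with h0
    · simp
    · simp [h0]
  have hθφ : ∀ k, θ k * φ k = (‖φ k‖ : ℂ) := fun k => by
    simp only [θ]
    split_ifs with h0
    · simp [h0]
    · have : (‖φ k‖ : ℂ) ≠ 0 := by simpa using h0
      rw [div_mul_eq_mul_div, mul_comm, Complex.mul_conj, Complex.normSq_eq_norm_sq]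
      push_cast
      field_simp
  have h1 := h F θ hθ
  simp only [hθφ, ← Complex.ofReal_sum, Complex.norm_real] at h1
  have h2 : n * ε ≤ ∑ k ∈ F, ‖φ k‖ := by
    rw [← hFn, ← nsmul_eq_mul]
    exact Finset.card_nsmul_le_sum _ _ _ fun k hk => by simpa using hF hk
  rw [hFn] at h1
  have h3 : n * ε ≤ C * √n := h2.trans ((Real.le_norm_self _).trans h1)
  have hn0 : (0 : ℝ) < n := lt_of_le_of_lt (sq_nonneg _) hn
  have hs : 0 < √(n : ℝ) := Real.sqrt_pos.2 hn0
  have h4 : √(n : ℝ) * ε ≤ C := by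
    refine le_of_mul_le_mul_right ?_ hs
    calc √(n : ℝ) * ε * √n = (√(n : ℝ) * √n) * ε := by ring
      _ = n * ε := by rw [Real.mul_self_sqrt hn0.le]
      _ ≤ _ := h3
  have h5 : √(n : ℝ) ≤ C / ε := (le_div_iff₀ hε).2 h4
  have h6 := pow_le_pow_left₀ hs.le h5 2
  rw [Real.sq_sqrt hn0.le] at h6
  linarith

/-! ### Conjugate-linear operators on Kalton's space -/

namespace kaltonSpace

section Operators

variable {A : kaltonSpace α →ₛₗ[starRingEnd ℂ] kaltonSpace α} {C : ℝ}

theorem quasiNorm_sum_smul_map_sndBasis_le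
    (hA : ∀ z, kaltonQuasiNorm α (A z) ≤ C * kaltonQuasiNorm α z) (F : Finset ℕ) {θ : ℕ → ℂ}
    (hθ : ∀ k, ‖θ k‖ = 1) :
    kaltonQuasiNorm α (∑ k ∈ F, θ k • A (sndBasis α k)) ≤ C * √F.card := by
  have h1 := hA (∑ k ∈ F, (starRingEnd ℂ) (θ k) • sndBasis α k)
  rw [quasiNorm_sum_sndBasis F (θ := fun k => (starRingEnd ℂ) (θ k)) fun k => by
    rw [Complex.norm_conj, hθ], map_sum] at h1
  simpa only [LinearMap.map_smulₛₗ, Complex.conj_conj] using h1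

theorem quasiNorm_sum_smul_map_flat_le
    (hA : ∀ z, kaltonQuasiNorm α (A z) ≤ C * kaltonQuasiNorm α z) (F : Finset ℕ) {θ : ℕ → ℂ}
    (hθ : ∀ k, ‖θ k‖ = 1) :
    kaltonQuasiNorm α (∑ k ∈ F, θ k • (A (fstBasis α k)
      + (starRingEnd ℂ) (kaltonFun α (Real.log √F.card)) • A (sndBasis α k)))
        ≤ C * √F.card := by
  have h1 := hA (∑ k ∈ F, (starRingEnd ℂ) (θ k) • (fstBasis α k
    + kaltonFun α (Real.log √F.card) • sndBasis α k))
  rw [quasiNorm_sum_flat F (θ := fun k => (starRingEnd ℂ) (θ k)) fun k => by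
    rw [Complex.norm_conj, hθ], map_sum] at h1
  simpa only [LinearMap.map_smulₛₗ, Complex.conj_conj, map_add] using h1

theorem quasiNorm_map_sndBasis_le (hA : ∀ z, kaltonQuasiNorm α (A z) ≤ C * kaltonQuasiNorm α z)
    (k : ℕ) : kaltonQuasiNorm α (A (sndBasis α k)) ≤ C := by
  simpa using quasiNorm_sum_smul_map_sndBasis_le hA {k} (θ := 1) (by simp)

theorem quasiNorm_map_fstBasis_le (hA : ∀ z, kaltonQuasiNorm α (A z) ≤ C * kaltonQuasiNorm α z)
    (k : ℕ) : kaltonQuasiNorm α (A (fstBasis α k)) ≤ C := by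
  simpa [kaltonFun_zero] using quasiNorm_sum_smul_map_flat_le hA {k} (θ := 1) (by simp)

theorem tendsto_map_sndBasis_fst (hA : ∀ z, kaltonQuasiNorm α (A z) ≤ C * kaltonQuasiNorm α z)
    (j : ℕ) : Filter.Tendsto (fun k => (A (sndBasis α k)).1.1 j) Filter.atTop (nhds 0) :=
  tendsto_zero_of_norm_sum_le (C := C) fun F θ hθ => by
    refine le_trans (le_of_eq ?_) ((norm_fst_apply_le _ j).trans
      (quasiNorm_sum_smul_map_sndBasis_le hA F hθ))
    rw [coe_sum_fst, Finset.sum_apply]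
    rfl

theorem tendsto_map_sndBasis_snd (hA : ∀ z, kaltonQuasiNorm α (A z) ≤ C * kaltonQuasiNorm α z)
    (j : ℕ) : Filter.Tendsto (fun k => (A (sndBasis α k)).1.2 j) Filter.atTop (nhds 0) :=
  tendsto_zero_of_norm_sum_le (C := C) fun F θ hθ => by
    refine le_trans (le_of_eq ?_) ((norm_snd_apply_le _ j).trans
      (quasiNorm_sum_smul_map_sndBasis_le hA F hθ))
    rw [coe_sum_snd, Finset.sum_apply]
    rfl

/-- The quotient map `(x, y) ↦ x` carries the images of the vectors `(0, e_k)` to a null sequence: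
the sum of `n` disjoint vectors whose first components are bounded away from zero has a quasi-norm
of order at least `√n log n`, whereas the sum of `n` vectors `(0, e_k)` has quasi-norm `√n`. -/
theorem tendsto_l2Norm_map_sndBasis_fst
    (hA : ∀ z, kaltonQuasiNorm α (A z) ≤ C * kaltonQuasiNorm α z) :
    Filter.Tendsto (fun k => l2Norm (A (sndBasis α k)).1.1) Filter.atTop (nhds 0) := by
  rw [← Nat.cofinite_eq_atTop, Metric.tendsto_nhds]
  intro ε hε
  rw [Filter.eventually_cofinite]
  by_contra hinf
  obtain ⟨K, hKsub, hK, c, hKc⟩ := exists_blocks (fun k => (A (sndBasis α k)).2.1)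
    (tendsto_map_sndBasis_fst hA) (K := {k | ¬dist (l2Norm (A (sndBasis α k)).1.1) 0 < ε}) hinf
    (half_pos hε) fun k hk => by
      simp only [Set.mem_ofPred_eq, Real.dist_eq, sub_zero, abs_of_nonneg (l2Norm_nonneg _),
        not_lt] at hk
      linarith
  have hC : 0 ≤ C := (quasiNorm_nonneg _).trans (quasiNorm_map_sndBasis_le hA 0)
  have hK1 := one_le_triangleConst α
  have hm1 := one_le_maskConst α
  have hκ := kaltonLip_nonneg α
  set C' := triangleConst α * maskConst α * (C + 1) with hC'
  have hKm : 1 ≤ triangleConst α * maskConst α := one_le_mul_of_one_le_of_one_le hK1 hm1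
  have hCC' : C + 1 ≤ C' := le_mul_of_one_le_left (by linarith) hKm
  set D := 2 * (1 + kaltonLip α) * C' with hD
  -- The number `n` of blocks is so large that `log √n` exceeds the error.
  obtain ⟨n, hn1, hn⟩ : ∃ n : ℕ, 1 ≤ n ∧ 4 * D / ε < Real.log √n := by
    have h := Real.tendsto_log_atTop.comp (Real.tendsto_sqrt_atTop.comp
      tendsto_natCast_atTop_atTop)
    obtain ⟨n, hn1, hn⟩ := ((Filter.eventually_ge_atTop 1).and
      (h.eventually_gt_atTop (4 * D / ε))).exists
    exact ⟨n, hn1, hn⟩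
  obtain ⟨F, hF, hFn⟩ := hK.exists_subset_card_eq n
  have hFne : F.Nonempty := Finset.card_pos.1 (by omega)
  obtain ⟨k, hkF, hk⟩ := exists_block_hasL2Bound c hFne (fun k => A (sndBasis α k)) (fun _ => 0)
    (C := C') (by linarith) (fun k _ => (quasiNorm_map_sndBasis_le hA k).trans (by linarith))
    (∑ k ∈ F, blockProj α c k (A (sndBasis α k)))
    (by
      refine (quasiNorm_sum_blockProj_le c F _ fun θ hθ =>
        quasiNorm_sum_smul_map_sndBasis_le hA F hθ).trans ?_
      rw [hC', ← mul_assoc]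
      have := Real.sqrt_nonneg (F.card : ℝ)
      gcongr
      linarith)
    (by rw [coe_sum_fst]; rfl) (by rw [coe_sum_snd]; simp)
  rw [hFn] at hk
  have hL : 0 < Real.log √n := lt_of_le_of_lt (by positivity) hn
  have hbound : HasL2Bound (mulSeq (blockMask c k) (A (sndBasis α k)).1.1)
      ((Real.log √n)⁻¹ * D) := hk.of_norm_le_mul (inv_nonneg.2 hL.le) fun j => by
    rw [← div_eq_inv_mul, le_div_iff₀ hL, mulSeq_apply, mulSeq_apply, norm_mul, norm_mul,
      mul_assoc]
    refine mul_le_mul_of_nonneg_left ?_ (norm_nonneg _)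
    rw [Pi.zero_apply, zero_sub, norm_neg, norm_mul]
    refine mul_le_mul_of_nonneg_left (sub_le_norm_kaltonFun_sub α ?_ hL.le) (norm_nonneg _)
    exact log_div_norm_nonneg ((norm_fst_apply_le _ j).trans
      ((quasiNorm_map_sndBasis_le hA k).trans (by linarith)))
  have h1 := (hKc k (hF hkF)).trans hbound.le
  rw [← div_eq_inv_mul, le_div_iff₀ hL] at h1
  rw [div_lt_iff₀ hε] at hn
  linarith

/-- A bounded conjugate-linear operator on `Z_α` is not bounded from below: the second components of
the images of the vectors `(0, e_k)` cannot stay away from zero, since the vectors `(x, Ω_α x)` for flat `x` would have to be mapped, block by block, to vectors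
whose phases fit `Ω_α` on many scales at once. -/
theorem not_bounded_below (hα : α ≠ 0)
    (hA : ∀ z, kaltonQuasiNorm α (A z) ≤ C * kaltonQuasiNorm α z) {d : ℝ} (hd : 0 < d)
    (hAd : ∀ z, d * kaltonQuasiNorm α z ≤ kaltonQuasiNorm α (A z)) : False := by
  have hC : 0 ≤ C := (quasiNorm_nonneg _).trans (quasiNorm_map_sndBasis_le hA 0)
  have hK1 := one_le_triangleConst α
  have hm1 := one_le_maskConst α
  have hκ := kaltonLip_nonneg α
  have hKm : 1 ≤ triangleConst α * maskConst α := one_le_mul_of_one_le_of_one_le hK1 hm1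
  have hKm0 : 0 < triangleConst α * maskConst α := zero_lt_one.trans_le hKm
  set C' := triangleConst α * (triangleConst α * maskConst α * C + 1) with hC'
  have hCC' : C + 1 ≤ C' := by
    have h1 : C ≤ triangleConst α * maskConst α * C := le_mul_of_one_le_left hC hKm
    have h2 : triangleConst α * maskConst α * C + 1 ≤ C' :=
      le_mul_of_one_le_left (by linarith) hK1
    linarith
  set E := 2 * (1 + kaltonLip α) * C' with hE
  have hE0 : 0 ≤ E := by positivity
  obtain ⟨T, D, hD, hscale⟩ := exists_scales_mul_norm_le hα
  -- The scales are the multiples `j * log √a`, attained by flat vectors with `a ^ j` coordinates.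
  obtain ⟨a, ha1, ha⟩ : ∃ a : ℕ, 1 ≤ a ∧ 4 * (D * (T.card * E)) / d < Real.log √a := by
    have h := Real.tendsto_log_atTop.comp (Real.tendsto_sqrt_atTop.comp
      tendsto_natCast_atTop_atTop)
    obtain ⟨a, ha1, ha⟩ := ((Filter.eventually_ge_atTop 1).and
      (h.eventually_gt_atTop (4 * (D * (T.card * E)) / d))).exists
    exact ⟨a, ha1, ha⟩
  set Λ := Real.log √a with hΛ
  have hΛ0 : 0 < Λ := lt_of_le_of_lt (by positivity) ha
  have hlog : ∀ j : ℕ, Real.log √((a ^ j : ℕ) : ℝ) = Λ * j := fun j => by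
    rw [hΛ, Real.log_sqrt (Nat.cast_nonneg _), Real.log_sqrt (Nat.cast_nonneg _), Nat.cast_pow,
      Real.log_pow]
    ring
  let N : ℕ := ∑ j ∈ T, a ^ j
  let η : ℝ := min (d / 4) (1 / (triangleConst α * maskConst α * (N + 1)))
  have hη0 : 0 < η := lt_min (by positivity) (by positivity)
  have hη1 : η ≤ d / 4 := min_le_left _ _
  have hη2 : triangleConst α * maskConst α * (N + 1) * η ≤ 1 := by
    have : η ≤ 1 / (triangleConst α * maskConst α * (N + 1)) := min_le_right _ _
    rwa [le_div_iff₀' (by positivity)] at this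
  let s : ℕ → ℕ → ℂ := fun k => (A (sndBasis α k)).1.1
  have hs : ∀ k, Memℓp (s k) 2 := fun k => (A (sndBasis α k)).2.1
  let r : ℕ → ℕ → ℂ := fun k => (A (sndBasis α k)).1.2 - kaltonMap α (s k)
  have hs0 := tendsto_l2Norm_map_sndBasis_fst hA
  have hr0 : ∀ j, Filter.Tendsto (fun k => r k j) Filter.atTop (nhds 0) := fun j => by
    have h1 : Filter.Tendsto (fun k => kaltonMap α (s k) j) Filter.atTop (nhds 0) :=
      squeeze_zero_norm (fun k => norm_kaltonMap_le α (hs k) j) hs0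
    have h2 := (tendsto_map_sndBasis_snd hA j).sub h1
    rwa [sub_zero] at h2
  have hK0 : {k | l2Norm (s k) < η}.Infinite :=
    Nat.frequently_atTop_iff_infinite.1 (hs0.eventually_lt_const hη0).frequently
  obtain ⟨K, hKsub, hK, c, hKc⟩ := exists_blocks (r := r) (fun k => (A (sndBasis α k)).2.2)
    hr0 hK0 (half_pos hd) fun k hk => by
      have h1 := hAd (sndBasis α k)
      have h2 : kaltonQuasiNorm α (sndBasis α k) = 1 := by
        simpa using quasiNorm_sum_sndBasis (α := α) {k} (θ := 1) (by simp)
      have h3 : kaltonQuasiNorm α (A (sndBasis α k)) = l2Norm (s k) + l2Norm (r k) := rfl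
      have h4 : l2Norm (s k) < η := hk
      rw [h2, h3] at h1
      linarith
  let g : ℕ → ℕ → ℕ → ℂ := fun j k i => (starRingEnd ℂ) (kaltonFun α (Λ * j)) * r k i
    - (A (fstBasis α k)).1.1 i
      * (kaltonFun α (Real.log (C' / ‖(A (fstBasis α k)).1.1 i‖) + Λ * j)
        - kaltonFun α (Real.log (C' / ‖(A (fstBasis α k)).1.1 i‖)))
  have hfin : ∀ j ∈ T, {k ∈ K | ¬HasL2Bound (mulSeq (blockMask c k) (g j k)) E}.Finite :=
    fun j hj => by
      by_contra hinf
      obtain ⟨F, hF, hFn⟩ := Set.Infinite.exists_subset_card_eq hinf (a ^ j)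
      have hn1 : 1 ≤ F.card := by
        rw [hFn]
        exact Nat.one_le_pow _ _ ha1
      have hnN : (F.card : ℝ) ≤ N := by
        rw [hFn]
        exact_mod_cast Finset.single_le_sum (f := fun j => a ^ j) (fun _ _ => Nat.zero_le _) hj
      have hL : Real.log √(F.card : ℝ) = Λ * j := by rw [hFn, hlog]
      have hn0 : 0 < √(F.card : ℝ) := Real.sqrt_pos.2 (by exact_mod_cast hn1)
      set b := (starRingEnd ℂ) (kaltonFun α (Λ * j)) with hb
      have hbn : ‖b‖ ≤ √(F.card : ℝ) := by
        rw [hb, Complex.norm_conj, norm_kaltonFun α (by positivity), ← hL]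
        exact Real.log_le_self hn0.le
      -- The images of `(0, e_k)` are replaced by their second components `(0, r k)`.
      let X : kaltonSpace α :=
        ∑ k ∈ F, blockProj α c k (A (fstBasis α k) + b • A (sndBasis α k))
      let Y : kaltonSpace α := ∑ k ∈ F, blockProj α c k (graph α (hs k))
      have hX : kaltonQuasiNorm α X ≤ triangleConst α * maskConst α * (C * √F.card) :=
        quasiNorm_sum_blockProj_le c F _ fun θ hθ => by
          have := quasiNorm_sum_smul_map_flat_le hA F hθ
          rwa [hL] at this
      have hY : kaltonQuasiNorm α Y ≤ 1 := by
        refine (quasiNorm_sum_le F _).trans ?_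
        have h1 : ∑ k ∈ F, kaltonQuasiNorm α (blockProj α c k (graph α (hs k)))
            ≤ F.card • (maskConst α * η) := Finset.sum_le_card_nsmul _ _ _ fun k hk => by
          refine (quasiNorm_lift_mulSeq_le (norm_blockMask_le c k) (graph α (hs k))).trans ?_
          rw [quasiNorm_graph]
          have h2 : l2Norm (s k) < η := hKsub (hF hk).1
          exact mul_le_mul_of_nonneg_left h2.le (zero_le_one.trans hm1)
        calc _ ≤ triangleConst α * (F.card • (maskConst α * η)) :=
              mul_le_mul_of_nonneg_left h1 (zero_le_one.trans hK1)
          _ = triangleConst α * maskConst α * F.card * η := by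
              rw [nsmul_eq_mul]
              ring
          _ ≤ triangleConst α * maskConst α * (N + 1) * η := by
              gcongr
              linarith
          _ ≤ 1 := hη2
      have hW : kaltonQuasiNorm α (X + (-b) • Y) ≤ C' * √F.card := by
        refine (quasiNorm_add_le _ _).trans ?_
        rw [quasiNorm_smul, norm_neg, hC', mul_assoc]
        refine mul_le_mul_of_nonneg_left ?_ (zero_le_one.trans hK1)
        have h1 : ‖b‖ * kaltonQuasiNorm α Y ≤ √(F.card : ℝ) * 1 := by
          have := quasiNorm_nonneg Y
          gcongr
        linarith
      have hW1 : (X + (-b) • Y).1.1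
          = ∑ k ∈ F, mulSeq (blockMask c k) (A (fstBasis α k)).1.1 := by
        have e1 : X.1.1 = ∑ k ∈ F, mulSeq (blockMask c k) ((A (fstBasis α k)).1.1 + b • s k) :=
          coe_sum_fst F _
        have e2 : Y.1.1 = ∑ k ∈ F, mulSeq (blockMask c k) (s k) := coe_sum_fst F _
        change X.1.1 + (-b) • Y.1.1 = _
        rw [e1, e2, Finset.smul_sum, ← Finset.sum_add_distrib]
        refine Finset.sum_congr rfl fun k _ => ?_
        rw [← map_smul, ← map_add]
        congr 1
        module
      have hW2 : (X + (-b) • Y).1.2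
          = ∑ k ∈ F, mulSeq (blockMask c k) ((A (fstBasis α k)).1.2 + b • r k) := by
        have e1 : X.1.2 = ∑ k ∈ F, mulSeq (blockMask c k)
            ((A (fstBasis α k)).1.2 + b • (A (sndBasis α k)).1.2) := coe_sum_snd F _
        have e2 : Y.1.2 = ∑ k ∈ F, mulSeq (blockMask c k) (kaltonMap α (s k)) := coe_sum_snd F _
        change X.1.2 + (-b) • Y.1.2 = _
        rw [e1, e2, Finset.smul_sum, ← Finset.sum_add_distrib]
        refine Finset.sum_congr rfl fun k _ => ?_
        rw [← map_smul, ← map_add]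
        congr 1
        simp only [r]
        module
      obtain ⟨k, hkF, hk⟩ := exists_block_hasL2Bound c (Finset.card_pos.1 hn1)
        (fun k => A (fstBasis α k)) (fun k => b • r k) (C := C') (by linarith)
        (fun k _ => (quasiNorm_map_fstBasis_le hA k).trans (by linarith)) _ hW hW1 hW2
      rw [hL] at hk
      exact (hF hkF).2 hk
  obtain ⟨k, hkK, hk⟩ := (hK.sdiff (T.finite_toSet.biUnion hfin)).nonempty
  have hg : ∀ j ∈ T, HasL2Bound (mulSeq (blockMask c k) (g j k)) E := fun j hj => by
    by_contra hcon
    exact hk (Set.mem_biUnion hj ⟨hkK, hcon⟩)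
  have hsum := HasL2Bound.sum T fun j hj => (hg j hj).abs
  rw [Finset.sum_const, nsmul_eq_mul] at hsum
  have hbound : HasL2Bound (mulSeq (blockMask c k) (r k)) (D / Λ * (T.card * E)) := by
    refine hsum.of_norm_le_mul (by positivity) fun i => ?_
    rw [Finset.sum_apply]
    simp only [mulSeq_blockMask_apply]
    split_ifs with hi
    · rw [← Complex.ofReal_sum, Complex.norm_real,
        Real.norm_of_nonneg (Finset.sum_nonneg fun _ _ => norm_nonneg _), div_mul_eq_mul_div,
        le_div_iff₀' hΛ0]
      exact hscale Λ _ _ _ hΛ0 (log_div_norm_nonneg ((norm_fst_apply_le _ i).trans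
        ((quasiNorm_map_fstBasis_le hA k).trans (by linarith))))
    · rw [norm_zero]
      positivity
  have h1 := (hKc k hkK).trans hbound.le
  rw [div_mul_eq_mul_div, le_div_iff₀ hΛ0] at h1
  rw [div_lt_iff₀ hd] at ha
  linarith

end Operators

end kaltonSpace

/-! ### Conjugate classes -/

theorem id_mem_kaltonIdeal (α : ℝ) :
    ContinuousLinearMap.id ℂ (KaltonBanach.{u} α) ∈ kaltonIdeal.{u} α (KaltonBanach α)
      (KaltonBanach α) :=
  ⟨KaltonBanach.toKalton.toLinearMap, KaltonBanach.toKalton.symm.toLinearMap,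
    ⟨kaltonSpace.triangleConst α, fun z => KaltonBanach.quasiNorm_le z⟩,
    ⟨1, fun z => by simpa using KaltonBanach.norm_le (KaltonBanach.toKalton.symm z)⟩,
    fun z => by simp⟩

/-- The identity of `Z_α` belongs to the ideal, but that of the conjugate space does not. -/
theorem not_isSelfConjugate_kaltonIdeal (hα : α ≠ 0) :
    ¬(kaltonIdeal.{u} α).IsSelfConjugate := by
  intro h
  have hid := id_mem_kaltonIdeal.{u} α
  rw [h] at hid
  obtain ⟨A, B, hA, hB, hAB⟩ := hid
  obtain ⟨a, ha, hA⟩ := exists_nonneg_bound (fun x => norm_nonneg x) hA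
  obtain ⟨b, hb, hB⟩ := exists_nonneg_bound kaltonSpace.quasiNorm_nonneg hB
  let A' : kaltonSpace α →ₛₗ[starRingEnd ℂ] kaltonSpace α :=
    { toFun := fun z => A (ConjSpace.mk ((KaltonBanach.toKalton.{u} (α := α)).symm z))
      map_add' := fun z w => by simp
      map_smul' := fun c z => by
        rw [← map_smul, ConjSpace.smul_def]
        simp }
  have hA' : ∀ z : KaltonBanach.{u} α,
      A' (KaltonBanach.toKalton z) = A (ConjSpace.mk z) := fun z => by
    change A (ConjSpace.mk (KaltonBanach.toKalton.symm (KaltonBanach.toKalton z))) = _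
    rw [LinearEquiv.symm_apply_apply]
  have hsurj := (KaltonBanach.toKalton.{u} (α := α)).surjective
  have hK := zero_lt_one.trans_le (kaltonSpace.one_le_triangleConst α)
  refine kaltonSpace.not_bounded_below (A := A') (C := a)
    (d := 1 / (kaltonSpace.triangleConst α * (b + 1))) hα
    (fun z => ?_) (by positivity) fun z => ?_
  · obtain ⟨z, rfl⟩ := hsurj z
    rw [hA']
    exact (hA _).trans (mul_le_mul_of_nonneg_left (KaltonBanach.norm_le z) ha)
  · obtain ⟨z, rfl⟩ := hsurj z
    rw [hA', one_div, inv_mul_le_iff₀ (by positivity)]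
    refine (KaltonBanach.quasiNorm_le z).trans ?_
    rw [mul_assoc]
    refine mul_le_mul_of_nonneg_left ?_ hK.le
    have h1 : ‖z‖ ≤ b * kaltonQuasiNorm α (A (ConjSpace.mk z)) :=
      (congrArg norm (hAB (ConjSpace.mk z))).trans_le (hB _)
    linarith [kaltonSpace.quasiNorm_nonneg (A (ConjSpace.mk z))]

/-- The identity from a complex Banach space to its conjugate as an operator between the
underlying real spaces. -/
noncomputable def ConjSpace.mkReal (X : Type u) [NormedAddCommGroup X] [NormedSpace ℂ X] :
    X →L[ℝ] ConjSpace X where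
  toFun := ConjSpace.mk
  map_add' := map_add ConjSpace.mk
  map_smul' r x := by
    rw [RingHom.id_apply, ← Complex.coe_smul, ← Complex.coe_smul, ConjSpace.smul_def]
    simp
  cont := continuous_id

/-- The identity from the conjugate of a complex Banach space as an operator between the
underlying real spaces. -/
noncomputable def ConjSpace.ofReal (X : Type u) [NormedAddCommGroup X] [NormedSpace ℂ X] :
    ConjSpace X →L[ℝ] X where
  toFun := ConjSpace.mk.symm
  map_add' := map_add ConjSpace.mk.symm
  map_smul' r x := by
    rw [RingHom.id_apply, ← Complex.coe_smul, ← Complex.coe_smul, ConjSpace.smul_def]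
    simp
  cont := continuous_id

/-- Over the reals a space and its conjugate cannot be distinguished. -/
theorem IsOperatorIdeal.isSelfConjugate_toComplex {A : OperatorClass.{u} ℝ}
    (hA : IsOperatorIdeal A) : A.toComplex.IsSelfConjugate := by
  funext X Y _ _ _ _ _ _
  ext T
  constructor
  · intro hT
    exact hA.comp_mem (ConjSpace X) X Y (ConjSpace Y) (ConjSpace.ofReal X) (T.restrictScalars ℝ)
      (ConjSpace.mkReal Y) hT
  · intro hT
    exact hA.comp_mem X (ConjSpace X) (ConjSpace Y) Y (ConjSpace.mkReal X)
      ((conjOperator T).restrictScalars ℝ) (ConjSpace.ofReal Y) hT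

/-- For `α ≠ 0` the operators factoring over `Z_α` form a complex operator ideal, this ideal is not
self-conjugate, and it does not come from any real operator ideal. -/
theorem mainTheorem1 (α : ℝ) (hα : α ≠ 0) :
    IsOperatorIdeal (kaltonIdeal.{u} α) ∧
    ¬ (kaltonIdeal.{u} α).IsSelfConjugate ∧
    ¬ ∃ A : OperatorClass.{u} ℝ, IsOperatorIdeal A ∧ A.toComplex = kaltonIdeal.{u} α :=
  ⟨isOperatorIdeal_kaltonIdeal α, not_isSelfConjugate_kaltonIdeal hα, fun ⟨_, hA, h⟩ =>
    not_isSelfConjugate_kaltonIdeal hα (h ▸ hA.isSelfConjugate_toComplex)⟩
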